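/- **Setting.** Let $(K,E_0)$ be a finite connected simple graph, $N\ge 1$, and attach $N$ half-lines $L_\alpha=\{1,2,\dots\}$ $(\alpha=1,\dots,N)$ to $K$ at vertices $x_\alpha\in K$ (not necessarily distinct); let $G=K\cup L_1\cup\dots\cup L_N$. The free operator $H_0$ acts on functions $u\colon G\to\mathbb C$ by $$(H_0u)[x]=\sum_{y\in K,\;y\sim x}(u[x]-u[y])+\#\{\alpha : x_\alpha=x\}\,u[x]\quad(x\in K),$$ and on each $L_\alpha$ by $(H_0u)[1]=2u[1]-u[2]$ and $(H_0u)[n]=2u[n]-u[n+1]-u[n-1]$ for $n\ge 2$. It is bounded on $\mathcal H=\ell^2(G)$. For $s\in\mathbb R$ let $\langle x\rangle=1$ on $K$ and $\langle n\rangle=(1+n^2)^{1/2}$ on each $L_\alpha$, and let $$\mathcal L^s=\Bigl\{u:\sum_{x}\langle x\rangle^{s}|u[x]|<\infty\Bigr\},\qquad (\mathcal L^s)^*=\Bigl\{u:\sup_x\langle x\rangle^{-s}|u[x]|<\infty\Bigr\},\qquad \mathcal B^s=\mathcal B\bigl(\mathcal L^s,(\mathcal L^s)^*\bigr),$$ with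 the natural norms and the duality $\langle\psi,u\rangle=\sum_x\overline{\psi[x]}\,u[x]$. Let $\mathbf 1^{(\alpha)}$ be the indicator function of $L_\alpha$ and $\mathbb C\mathbf 1$ the span of $\mathbf 1^{(1)},\dots,\mathbf 1^{(N)}$. **Perturbation.** Let $\beta\ge 2$ be an integer, and let $V\in\mathcal B(\mathcal H)$ be self-adjoint with $V=vUv^*$, where $v\in\mathcal B(\mathcal K,\mathcal L^\beta)$ is injective, $U\in\mathcal B(\mathcal K)$ is self-adjoint and unitary, and $\mathcal K$ is a Hilbert space. Then $V$ extends to $vUv^*\in\mathcal B((\mathcal L^\beta)^*,\mathcal L^\beta)$. Put $H=H_0+V$, $R(\kappa)=(H+\kappa^2)^{-1}$ for $-\kappa^2\notin\sigma(H)$, and $$\widetilde{\mathcal E}=\{\Psi\in(\mathcal L^\beta)^* : H\Psi=0\},\qquad \mathcal E=\widetilde{\mathcal E}\cap(\mathbb C\mathbf 1\oplus\mathcal L^{\beta-2}),\qquad \mathsf E=\widetilde{\mathcal E}\cap\mathcal L^{\beta-2}.$$ Let $\mathsf P=\sum_\gamma|\Psi_\gamma\rangle\langle\Psi_\gamma|$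 for a basis $\{\Psi_\gamma\}$ of $\mathsf E$ with $\overline{\Psi}_{\gamma'}\Psi_\gamma\in\mathcal L^0$ and $\langle\Psi_{\gamma'},\Psi_\gamma\rangle=\delta_{\gamma\gamma'}$ (the orthogonal bound projection). Let $\mathcal P=\sum_\gamma|\Psi_\gamma\rangle\langle\Psi_\gamma|$ for a family $\{\Psi_\gamma\}\subset\mathcal E$ whose classes form a basis of $\mathcal E/\mathsf E$, with $\overline\Psi\Psi_\gamma\in\mathcal L^0$ and $\langle\Psi,\Psi_\gamma\rangle=0$ for all $\Psi\in\mathsf E$, and with $\Psi_\gamma-\sum_\alpha c^{(\gamma)}_\alpha\mathbf 1^{(\alpha)}\in\mathcal L^{\beta-2}$ for some orthonormal system $\{c^{(\gamma)}\}\subset\mathbb C^N$ (the orthogonal resonance projection). **Theorem.** Assume that the threshold $0$ is a regular point, i.e. $\mathcal E=\mathsf E=\{0\}$. Then $-\kappa^2\notin\sigma(H)$ for all sufficiently small $\kappa\in\mathbb C$ with $\operatorname{Re}\kappa>0$, and there are operators $G_j\in\mathcal B^\beta$ $(-2\le j\le\beta-2)$ such that, as $\kappa\to0$ with $\operatorname{Re}\kappa>0$,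 $$R(\kappa)=\sum_{j=-2}^{\beta-2}\kappa^jG_j+\mathcal O(\kappa^{\beta-1})\quad\text{in }\mathcal B^{\beta}.$$ For $0\le j\le\beta-2$ one has $G_j\in\mathcal B^{j+1}$ if $j$ is even and $G_j\in\mathcal B^{j}$ if $j$ is odd. There is no singular part: $\mathsf P$ and $\mathcal P$ exist and do not depend on the choice of the bases, and $$G_{-2}=\mathsf P=0,\qquad G_{-1}=\mathcal P=0,$$ so that the sum starts at $j=0$. -/

import Mathlib

noncomputable section

namespace RayGraph

/-- The vertex set `G = K ∪ L₁ ∪ … ∪ L_N` of a graph with `N` rays: `Sum.inl x` is the vertex `x` of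
the finite graph `K`, and `Sum.inr (α, n)` is the vertex `n + 1` of the `α`-th half-line
`L_α = {1, 2, …}`. -/
abbrev Vtx (K : Type*) (N : ℕ) := K ⊕ (Fin N × ℕ)

section Spaces

variable {K : Type*} {N : ℕ}

/-- The weight of order `s`: it is `1` on `K`, and `(1 + m²)^(s/2)` at the vertex `m = n + 1` of a
half-line. -/
def wt (s : ℝ) : Vtx K N → ℝ
  | Sum.inl _ => 1
  | Sum.inr (_, n) => (1 + ((n : ℝ) + 1) ^ 2) ^ (s / 2)

lemma wt_pos (s : ℝ) (x : Vtx K N) : 0 < wt s x := by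
  rcases x with x | ⟨α, n⟩
  · exact one_pos
  · simp only [wt]; positivity

lemma wt_neg_mul (s : ℝ) (x : Vtx K N) : wt (-s) x * wt s x = 1 := by
  rcases x with x | ⟨α, n⟩
  · simp [wt]
  · simp only [wt]
    rw [← Real.rpow_add (by positivity)]
    simp [neg_div]

lemma one_le_wt {s : ℝ} (hs : 0 ≤ s) (x : Vtx K N) : 1 ≤ wt s x := by
  rcases x with x | ⟨α, n⟩
  · exact le_rfl
  · exact Real.one_le_rpow (by nlinarith [sq_nonneg ((n : ℝ) + 1)]) (by positivity)

lemma wt_neg_le_one {s : ℝ} (hs : 0 ≤ s) (x : Vtx K N) : wt (-s) x ≤ 1 := by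
  have h1 := wt_neg_mul s x
  have h2 := one_le_wt hs x
  nlinarith [wt_pos (-s) x]

variable (K N)

/-- `ℓ^{1,s}(G)` as a space of functions on `G`. -/
def l1Sub (s : ℝ) : Submodule ℂ (Vtx K N → ℂ) where
  carrier := {u | Summable fun x => wt s x * ‖u x‖}
  zero_mem' := by simp [summable_zero]
  add_mem' := by
    intro u w hu hw
    refine Summable.of_nonneg_of_le (fun x => mul_nonneg (wt_pos s x).le (norm_nonneg _))
      (fun x => ?_) (Summable.add hu hw)
    rw [← mul_add]
    exact mul_le_mul_of_nonneg_left (norm_add_le _ _) (wt_pos s x).le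
  smul_mem' := by
    intro c u hu
    refine (Summable.mul_left ‖c‖ hu).congr fun x => ?_
    simp only [Pi.smul_apply, smul_eq_mul, norm_mul]; ring

/-- `ℓ^{∞,-s}(G)` as a space of functions on `G`. -/
def linfSub (s : ℝ) : Submodule ℂ (Vtx K N → ℂ) where
  carrier := {u | BddAbove (Set.range fun x => wt (-s) x * ‖u x‖)}
  zero_mem' := ⟨0, by rintro _ ⟨x, rfl⟩; simp⟩
  add_mem' := by
    rintro u w ⟨A, hA⟩ ⟨B, hB⟩
    refine ⟨A + B, ?_⟩
    rintro _ ⟨x, rfl⟩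
    have h1 := hA ⟨x, rfl⟩
    have h2 := hB ⟨x, rfl⟩
    have h3 := mul_le_mul_of_nonneg_left (norm_add_le (u x) (w x)) (wt_pos (-s) x).le
    simp only [Pi.add_apply] at *
    linarith
  smul_mem' := by
    rintro c u ⟨A, hA⟩
    refine ⟨‖c‖ * A, ?_⟩
    rintro _ ⟨x, rfl⟩
    have h1 := mul_le_mul_of_nonneg_left (hA ⟨x, rfl⟩) (norm_nonneg c)
    simp only [Pi.smul_apply, smul_eq_mul, norm_mul] at *
    linarith

/-- The Banach space `𝓛^s = ℓ^{1,s}(G)`, with the norm `∑ₓ wt s x * |u x|`. -/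
def Lone (s : ℝ) := ↥(l1Sub K N s)

/-- The Banach space `(𝓛^s)* = ℓ^{∞,-s}(G)`, with the norm `supₓ wt (-s) x * |u x|`. -/
def Linf (s : ℝ) := ↥(linfSub K N s)

variable {K N} {s : ℝ}

instance : AddCommGroup (Lone K N s) := inferInstanceAs (AddCommGroup ↥(l1Sub K N s))
instance : Module ℂ (Lone K N s) := inferInstanceAs (Module ℂ ↥(l1Sub K N s))
instance : AddCommGroup (Linf K N s) := inferInstanceAs (AddCommGroup ↥(linfSub K N s))
instance : Module ℂ (Linf K N s) := inferInstanceAs (Module ℂ ↥(linfSub K N s))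

instance : CoeFun (Lone K N s) (fun _ => Vtx K N → ℂ) := ⟨fun u => u.1⟩
instance : CoeFun (Linf K N s) (fun _ => Vtx K N → ℂ) := ⟨fun u => u.1⟩

/-- An element of `𝓛^s`, as a function. -/
def Lone.toFunₗ : Lone K N s →ₗ[ℂ] (Vtx K N → ℂ) := (l1Sub K N s).subtype

/-- An element of `(𝓛^s)*`, as a function. -/
def Linf.toFunₗ : Linf K N s →ₗ[ℂ] (Vtx K N → ℂ) := (linfSub K N s).subtype

lemma Lone.add_apply (u w : Lone K N s) (x : Vtx K N) : (u + w) x = u x + w x := rfl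
lemma Lone.smul_apply (c : ℂ) (u : Lone K N s) (x : Vtx K N) : (c • u) x = c * u x := rfl
lemma Linf.add_apply (u w : Linf K N s) (x : Vtx K N) : (u + w) x = u x + w x := rfl
lemma Linf.smul_apply (c : ℂ) (u : Linf K N s) (x : Vtx K N) : (c • u) x = c * u x := rfl

instance : Norm (Lone K N s) := ⟨fun u => ∑' x, wt s x * ‖u x‖⟩
instance : Norm (Linf K N s) := ⟨fun u => ⨆ x, wt (-s) x * ‖u x‖⟩

lemma Lone.norm_def (u : Lone K N s) : ‖u‖ = ∑' x, wt s x * ‖u x‖ := rfl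
lemma Linf.norm_def (u : Linf K N s) : ‖u‖ = ⨆ x, wt (-s) x * ‖u x‖ := rfl
lemma Lone.summable (u : Lone K N s) : Summable fun x => wt s x * ‖u x‖ := u.2
lemma Linf.bddAbove (u : Linf K N s) : BddAbove (Set.range fun x => wt (-s) x * ‖u x‖) := u.2

lemma Lone.le_norm (u : Lone K N s) (x : Vtx K N) : wt s x * ‖u x‖ ≤ ‖u‖ :=
  u.summable.le_tsum x fun y _ => mul_nonneg (wt_pos s y).le (norm_nonneg _)

lemma Linf.le_norm (u : Linf K N s) (x : Vtx K N) : wt (-s) x * ‖u x‖ ≤ ‖u‖ :=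
  le_ciSup u.bddAbove x

lemma Linf.norm_le (u : Linf K N s) {C : ℝ} (hC : 0 ≤ C)
    (h : ∀ x, wt (-s) x * ‖u x‖ ≤ C) : ‖u‖ ≤ C :=
  Real.iSup_le h hC

lemma Lone.core : NormedSpace.Core ℂ (Lone K N s) where
  norm_nonneg u := tsum_nonneg fun x => mul_nonneg (wt_pos s x).le (norm_nonneg _)
  norm_smul c u := by
    rw [Lone.norm_def, Lone.norm_def, ← tsum_mul_left]
    refine tsum_congr fun x => ?_
    rw [Lone.smul_apply, norm_mul]; ring
  norm_triangle u w := by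
    rw [Lone.norm_def, Lone.norm_def, Lone.norm_def, ← u.summable.tsum_add w.summable]
    refine Summable.tsum_le_tsum (fun x => ?_) (u + w).summable (u.summable.add w.summable)
    rw [← mul_add]
    exact mul_le_mul_of_nonneg_left (norm_add_le _ _) (wt_pos s x).le
  norm_eq_zero_iff u := by
    constructor
    · intro h
      refine Subtype.ext (funext fun x => ?_)
      have h1 := u.le_norm x
      rw [h] at h1
      have h2 : ‖u x‖ ≤ 0 := by
        by_contra h3
        exact absurd h1 (not_le.2 (mul_pos (wt_pos s x) (not_le.1 h3)))
      exact norm_le_zero_iff.1 h2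
    · rintro rfl
      rw [Lone.norm_def]
      have : ∀ x : Vtx K N, (0 : Lone K N s) x = 0 := fun _ => rfl
      simp [this]

lemma Linf.core : NormedSpace.Core ℂ (Linf K N s) where
  norm_nonneg u := Real.iSup_nonneg fun x => mul_nonneg (wt_pos (-s) x).le (norm_nonneg _)
  norm_smul c u := by
    rw [Linf.norm_def, Linf.norm_def, Real.mul_iSup_of_nonneg (norm_nonneg c)]
    congr 1
    funext x
    rw [Linf.smul_apply, norm_mul]; ring
  norm_triangle u w := by
    have hn : ∀ u : Linf K N s, 0 ≤ ‖u‖ := fun u =>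
      Real.iSup_nonneg fun x => mul_nonneg (wt_pos (-s) x).le (norm_nonneg _)
    refine Linf.norm_le _ (add_nonneg (hn u) (hn w)) fun x => ?_
    have h3 := mul_le_mul_of_nonneg_left (norm_add_le (u x) (w x)) (wt_pos (-s) x).le
    rw [Linf.add_apply]
    linarith [u.le_norm x, w.le_norm x]
  norm_eq_zero_iff u := by
    constructor
    · intro h
      refine Subtype.ext (funext fun x => ?_)
      have h1 := u.le_norm x
      rw [h] at h1
      have h2 : ‖u x‖ ≤ 0 := by
        by_contra h3
        exact absurd h1 (not_le.2 (mul_pos (wt_pos (-s) x) (not_le.1 h3)))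
      exact norm_le_zero_iff.1 h2
    · rintro rfl
      rw [Linf.norm_def]
      have : ∀ x : Vtx K N, (0 : Linf K N s) x = 0 := fun _ => rfl
      simp [this]

instance : NormedAddCommGroup (Lone K N s) := NormedAddCommGroup.ofCore Lone.core
instance : NormedSpace ℂ (Lone K N s) := NormedSpace.ofCore Lone.core
instance : NormedAddCommGroup (Linf K N s) := NormedAddCommGroup.ofCore Linf.core
instance : NormedSpace ℂ (Linf K N s) := NormedSpace.ofCore Linf.core

variable (K N s) in
/-- The space `𝓑^s` of bounded operators from `𝓛^s` to `(𝓛^s)*`, with the operator norm. -/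
abbrev Bop := Lone K N s →L[ℂ] Linf K N s

/-- For `s ≤ t` an operator `T ∈ 𝓑^t` belongs to `𝓑^s` if it extends from `𝓛^t ⊆ 𝓛^s` to a bounded
operator from `𝓛^s` to `(𝓛^s)*`. -/
def Bop.MemB {t : ℝ} (T : Bop K N t) (s : ℝ) : Prop :=
  ∃ T' : Bop K N s, ∀ (u : Lone K N s) (w : Lone K N t),
    (∀ x, u x = w x) → ∀ x, T' u x = T w x

variable (K N) in
/-- The Hilbert space `𝓗 = ℓ²(G)`. -/
abbrev Hil := lp (fun _ : Vtx K N => ℂ) 2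

lemma Lone.norm_apply_le (hs : 0 ≤ s) (u : Lone K N s) (x : Vtx K N) : ‖u x‖ ≤ ‖u‖ := by
  have h1 := u.le_norm x
  have h2 := one_le_wt hs x
  nlinarith [norm_nonneg (u x)]

lemma Lone.summable_norm (hs : 0 ≤ s) (u : Lone K N s) : Summable fun x => ‖u x‖ := by
  refine Summable.of_nonneg_of_le (fun x => norm_nonneg _) (fun x => ?_) u.summable
  nlinarith [one_le_wt hs x, norm_nonneg (u x)]

lemma Lone.tsum_norm_le (hs : 0 ≤ s) (u : Lone K N s) : ∑' x, ‖u x‖ ≤ ‖u‖ := by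
  refine Summable.tsum_le_tsum (fun x => ?_) (u.summable_norm hs) u.summable
  nlinarith [one_le_wt hs x, norm_nonneg (u x)]

lemma Lone.memℓp (hs : 0 ≤ s) (u : Lone K N s) : Memℓp (u : Vtx K N → ℂ) 2 := by
  have h1 : Memℓp (u : Vtx K N → ℂ) 1 := by
    refine memℓp_gen ?_
    simpa using u.summable_norm hs
  exact h1.of_exponent_ge (by norm_num)

/-- The embedding of `𝓛^s` in `𝓗` for `s ≥ 0`. -/
def Lone.toHil (hs : 0 ≤ s) : Lone K N s →L[ℂ] Hil K N :=
  LinearMap.mkContinuous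
    { toFun := fun u => ⟨u.1, u.memℓp hs⟩
      map_add' := fun _ _ => rfl
      map_smul' := fun _ _ => rfl } 1 (by
    intro u
    rw [one_mul]
    refine lp.norm_le_of_tsum_le (by norm_num) (norm_nonneg u) ?_
    have h1 : ∀ x, ‖u x‖ ^ 2 ≤ ‖u‖ * ‖u x‖ := fun x => by
      nlinarith [u.norm_apply_le hs x, norm_nonneg (u x)]
    have h2 : Summable fun x => ‖u x‖ ^ 2 :=
      Summable.of_nonneg_of_le (fun x => by positivity) h1 ((u.summable_norm hs).mul_left _)
    have h3 : ∑' x, ‖u x‖ ^ 2 ≤ ‖u‖ ^ 2 := by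
      calc ∑' x, ‖u x‖ ^ 2 ≤ ∑' x, ‖u‖ * ‖u x‖ :=
            Summable.tsum_le_tsum h1 h2 ((u.summable_norm hs).mul_left _)
        _ = ‖u‖ * ∑' x, ‖u x‖ := tsum_mul_left
        _ ≤ ‖u‖ ^ 2 := by nlinarith [u.tsum_norm_le hs, norm_nonneg u]
    have e : (2 : ENNReal).toReal = ((2 : ℕ) : ℝ) := by norm_num
    rw [e]
    simp only [Real.rpow_natCast]
    exact h3)

/-- The embedding of `𝓗` in `(𝓛^s)*` for `s ≥ 0`. -/
def Linf.ofHil (hs : 0 ≤ s) : Hil K N →L[ℂ] Linf K N s :=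
  have key : ∀ (f : Hil K N) (x : Vtx K N), wt (-s) x * ‖f x‖ ≤ ‖f‖ := fun f x => by
    have h1 := lp.norm_apply_le_norm (by norm_num) f x
    nlinarith [wt_neg_le_one hs x, norm_nonneg (f x)]
  LinearMap.mkContinuous
    { toFun := fun f => ⟨f, ⟨‖f‖, by rintro _ ⟨x, rfl⟩; exact key f x⟩⟩
      map_add' := fun _ _ => rfl
      map_smul' := fun _ _ => rfl } 1 (by
    intro f
    rw [one_mul]
    exact Linf.norm_le _ (norm_nonneg f) (key f))

/-- A bounded operator on `𝓗` regarded as an element of `𝓑^s`, `s ≥ 0`, through the embeddings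
`𝓛^s ⊆ 𝓗 ⊆ (𝓛^s)*`. -/
def toBop (hs : 0 ≤ s) (A : Hil K N →L[ℂ] Hil K N) : Bop K N s :=
  (Linf.ofHil hs).comp (A.comp (Lone.toHil hs))

lemma pairing_le (ψ : Linf K N s) (u : Lone K N s) (x : Vtx K N) :
    ‖starRingEnd ℂ (ψ x) * u x‖ ≤ ‖ψ‖ * (wt s x * ‖u x‖) := by
  rw [norm_mul, RCLike.norm_conj]
  have h1 := ψ.le_norm x
  have h2 := wt_neg_mul s x
  have h3 : 0 ≤ wt s x * ‖u x‖ := mul_nonneg (wt_pos s x).le (norm_nonneg _)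
  calc ‖ψ x‖ * ‖u x‖ = (wt (-s) x * wt s x) * (‖ψ x‖ * ‖u x‖) := by rw [h2, one_mul]
    _ = (wt (-s) x * ‖ψ x‖) * (wt s x * ‖u x‖) := by ring
    _ ≤ _ := mul_le_mul_of_nonneg_right h1 h3

lemma pairing_summable (ψ : Linf K N s) (u : Lone K N s) :
    Summable fun x => starRingEnd ℂ (ψ x) * u x :=
  Summable.of_norm_bounded (u.summable.mul_left ‖ψ‖) (pairing_le ψ u)

/-- The duality `⟨ψ, u⟩ = ∑ₓ conj (ψ x) * u x` between `(𝓛^s)*` and `𝓛^s`, as a bounded linear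
functional of `u`. -/
def pairing (ψ : Linf K N s) : Lone K N s →L[ℂ] ℂ :=
  LinearMap.mkContinuous
    { toFun := fun u => ∑' x, starRingEnd ℂ (ψ x) * u x
      map_add' := fun u w => by
        rw [← (pairing_summable ψ u).tsum_add (pairing_summable ψ w)]
        exact tsum_congr fun x => by rw [Lone.add_apply, mul_add]
      map_smul' := fun c u => by
        rw [RingHom.id_apply, smul_eq_mul, ← tsum_mul_left]
        exact tsum_congr fun x => by rw [Lone.smul_apply]; ring } ‖ψ‖ (by
    intro u
    have h := tsum_of_norm_bounded (u.summable.mul_left ‖ψ‖).hasSum (pairing_le ψ u)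
    rwa [tsum_mul_left] at h)

lemma pairing_apply (ψ : Linf K N s) (u : Lone K N s) :
    pairing ψ u = ∑' x, starRingEnd ℂ (ψ x) * u x := rfl

end Spaces

section Free

variable {K : Type*} {N : ℕ} [Fintype K]

open Classical in
/-- The free operator `H₀ = h₀ ⊕ h₁ ⊕ … ⊕ h_N` on all functions on `G`, where `E₀` is the graph
structure of `K` and the `α`-th half-line is attached at the vertex `a α` of `K`: on `K` the
Dirichlet operator `(h₀ u)[x] = ∑_{y ∼ x} (u[x] - u[y]) + ∑_α s_α[x] u[x]`, and on every half-line
the Dirichlet Laplacian. -/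
def freeOp (E₀ : SimpleGraph K) (a : Fin N → K) : (Vtx K N → ℂ) →ₗ[ℂ] (Vtx K N → ℂ) where
  toFun u
    | Sum.inl x => (∑ y, if E₀.Adj x y then u (Sum.inl x) - u (Sum.inl y) else 0)
        + ∑ α, if x = a α then u (Sum.inl x) else 0
    | Sum.inr (α, 0) => 2 * u (Sum.inr (α, 0)) - u (Sum.inr (α, 1))
    | Sum.inr (α, n + 1) =>
        2 * u (Sum.inr (α, n + 1)) - u (Sum.inr (α, n + 2)) - u (Sum.inr (α, n))
  map_add' u w := by
    funext z
    rcases z with x | ⟨α, _ | n⟩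
    · simp only [Pi.add_apply]
      rw [add_add_add_comm, ← Finset.sum_add_distrib, ← Finset.sum_add_distrib]
      congr 1 <;> refine Finset.sum_congr rfl fun y _ => ?_ <;> split_ifs <;> ring
    · simp only [Pi.add_apply]; ring
    · simp only [Pi.add_apply]; ring
  map_smul' c u := by
    funext z
    rcases z with x | ⟨α, _ | n⟩
    · simp only [Pi.smul_apply, smul_eq_mul, RingHom.id_apply]
      rw [mul_add, Finset.mul_sum, Finset.mul_sum]
      congr 1 <;> refine Finset.sum_congr rfl fun y _ => ?_ <;> split_ifs <;> ring
    · simp only [Pi.smul_apply, smul_eq_mul, RingHom.id_apply]; ring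
    · simp only [Pi.smul_apply, smul_eq_mul, RingHom.id_apply]; ring

lemma freeOp_memℓp (E₀ : SimpleGraph K) (a : Fin N → K) (f : Hil K N) :
    Memℓp (freeOp E₀ a f) 2 := by
  have hf : Summable fun x => ‖f x‖ ^ 2 := by
    have := (lp.memℓp f).summable (by norm_num)
    simpa using this
  have hr : Summable fun p : Fin N × ℕ => ‖f (Sum.inr p)‖ ^ 2 :=
    hf.comp_injective Sum.inr_injective
  have hp : Summable fun p : Fin N × ℕ => ‖f (Sum.inr (p.1, p.2 + 1))‖ ^ 2 :=
    hr.comp_injective (i := fun p : Fin N × ℕ => (p.1, p.2 + 1)) (by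
      rintro ⟨α, n⟩ ⟨γ, m⟩ h
      simpa using h)
  let g : Fin N × ℕ → ℝ := fun p => if p.2 = 0 then 0 else ‖f (Sum.inr (p.1, p.2 - 1))‖ ^ 2
  have hg : Summable g := by
    have hi : Function.Injective (fun p : Fin N × ℕ => (p.1, p.2 + 1)) := by
      rintro ⟨α, n⟩ ⟨γ, m⟩ h
      simpa using h
    refine (hi.summable_iff ?_).1 (hr.congr fun p => ?_)
    · rintro ⟨α, _ | n⟩ h
      · simp [g]
      · exact absurd ⟨(α, n), rfl⟩ h
    · simp [g]
  have hray : Summable fun p : Fin N × ℕ => ‖freeOp E₀ a f (Sum.inr p)‖ ^ 2 := by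
    refine Summable.of_nonneg_of_le (fun p => by positivity) (fun p => ?_)
      (((hr.mul_left 12).add (hp.mul_left 3)).add (hg.mul_left 3))
    rcases p with ⟨α, _ | n⟩
    · change ‖2 * f (Sum.inr (α, 0)) - f (Sum.inr (α, 1))‖ ^ 2 ≤ _
      have h1 : ‖2 * f (Sum.inr (α, 0)) - f (Sum.inr (α, 1))‖
          ≤ 2 * ‖f (Sum.inr (α, 0))‖ + ‖f (Sum.inr (α, 1))‖ := by
        refine (norm_sub_le _ _).trans ?_
        simp
      simp only [g, if_true, zero_add]
      nlinarith [norm_nonneg (2 * f (Sum.inr (α, 0)) - f (Sum.inr (α, 1))),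
        norm_nonneg (f (Sum.inr (α, 0))), norm_nonneg (f (Sum.inr (α, 1))),
        sq_nonneg (2 * ‖f (Sum.inr (α, 0))‖ - ‖f (Sum.inr (α, 1))‖)]
    · change ‖2 * f (Sum.inr (α, n + 1)) - f (Sum.inr (α, n + 2)) - f (Sum.inr (α, n))‖ ^ 2 ≤ _
      have h1 : ‖2 * f (Sum.inr (α, n + 1)) - f (Sum.inr (α, n + 2)) - f (Sum.inr (α, n))‖
          ≤ 2 * ‖f (Sum.inr (α, n + 1))‖ + ‖f (Sum.inr (α, n + 2))‖ + ‖f (Sum.inr (α, n))‖ := by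
        refine (norm_sub_le _ _).trans (add_le_add ((norm_sub_le _ _).trans ?_) le_rfl)
        simp
      have h2 := pow_le_pow_left₀ (norm_nonneg _) h1 2
      refine h2.trans ?_
      have e : g (α, n + 1) = ‖f (Sum.inr (α, n))‖ ^ 2 := by simp [g]
      simp only [e]
      have e2 : n + 1 + 1 = n + 2 := rfl
      simp only [e2]
      nlinarith [sq_nonneg (2 * ‖f (Sum.inr (α, n + 1))‖ - ‖f (Sum.inr (α, n + 2))‖),
        sq_nonneg (2 * ‖f (Sum.inr (α, n + 1))‖ - ‖f (Sum.inr (α, n))‖),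
        sq_nonneg (‖f (Sum.inr (α, n + 2))‖ - ‖f (Sum.inr (α, n))‖)]
  refine memℓp_gen ?_
  suffices h : Summable fun x => ‖freeOp E₀ a f x‖ ^ 2 by simpa using h
  have h1 : Summable (Sum.elim (fun _ => 0) fun p => ‖freeOp E₀ a f (Sum.inr p)‖ ^ 2 :
      Vtx K N → ℝ) := by
    refine (Sum.inr_injective.summable_iff ?_).1 hray
    rintro (x | p) h
    · rfl
    · exact absurd ⟨p, rfl⟩ h
  have h2 : Summable (Sum.elim (fun x => ‖freeOp E₀ a f (Sum.inl x)‖ ^ 2) fun _ => 0 :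
      Vtx K N → ℝ) := by
    refine (Sum.inl_injective.summable_iff ?_).1 (Summable.of_finite)
    rintro (x | p) h
    · exact absurd ⟨x, rfl⟩ h
    · rfl
  refine (h1.add h2).congr ?_
  rintro (x | p) <;> simp

/-- The restriction of the free operator to `𝓗 = ℓ²(G)`, a bounded operator. -/
def freeHil (E₀ : SimpleGraph K) (a : Fin N → K) : Hil K N →L[ℂ] Hil K N :=
  ContinuousLinearMap.ofSeqClosedGraph
    (g := ({ toFun := fun f => ⟨freeOp E₀ a f, freeOp_memℓp E₀ a f⟩
             map_add' := fun f g => Subtype.ext ((freeOp E₀ a).map_add f g)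
             map_smul' := fun c f => Subtype.ext ((freeOp E₀ a).map_smul c f) } :
      Hil K N →ₗ[ℂ] Hil K N)) (by
    intro u f g hu hg
    have ev : ∀ x : Vtx K N, Continuous fun f : Hil K N => (f x : ℂ) := fun x =>
      (lp.evalCLM ℂ (fun _ : Vtx K N => ℂ) (p := 2) x).continuous
    refine Subtype.ext (funext fun z => ?_)
    have h1 := ((ev z).tendsto g).comp hg
    refine tendsto_nhds_unique h1 ?_
    have h2 : Continuous fun f : Hil K N => freeOp E₀ a f z := by
      rcases z with x | ⟨α, _ | n⟩
      · refine Continuous.add (continuous_finsetSum _ fun y _ => ?_)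
          (continuous_finsetSum _ fun α _ => ?_)
        · split_ifs
          · exact Continuous.sub (G := ℂ) (ev _) (ev _)
          · exact continuous_const
        · split_ifs
          · exact ev _
          · exact continuous_const
      · exact Continuous.sub (G := ℂ) (Continuous.mul (M := ℂ) continuous_const (ev _)) (ev _)
      · exact Continuous.sub (G := ℂ) (Continuous.sub (G := ℂ)
          (Continuous.mul (M := ℂ) continuous_const (ev _)) (ev _)) (ev _)
    exact (h2.tendsto f).comp hu)

lemma freeHil_apply (E₀ : SimpleGraph K) (a : Fin N → K) (f : Hil K N) (x : Vtx K N) :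
    freeHil E₀ a f x = freeOp E₀ a f x := rfl

end Free

section Perturbed

variable {K : Type*} {N : ℕ}
variable {𝒦 : Type*} [NormedAddCommGroup 𝒦] [InnerProductSpace ℂ 𝒦] [CompleteSpace 𝒦] {s : ℝ}

/-- The adjoint `v* : (𝓛^s)* → 𝒦` of a bounded operator `v : 𝒦 → 𝓛^s`, determined by
`⟨v* ψ, k⟩ = ⟨ψ, v k⟩`. -/
def adj (v : 𝒦 →L[ℂ] Lone K N s) : Linf K N s →ₗ[ℂ] 𝒦 where
  toFun ψ := (InnerProductSpace.toDual ℂ 𝒦).symm ((pairing ψ).comp v)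
  map_add' ψ φ := by
    rw [← map_add]
    congr 1
    ext k
    simp only [ContinuousLinearMap.comp_apply, add_apply, pairing_apply]
    rw [← (pairing_summable ψ (v k)).tsum_add (pairing_summable φ (v k))]
    exact tsum_congr fun x => by rw [Linf.add_apply, map_add, add_mul]
  map_smul' c ψ := by
    have h : (pairing (c • ψ)).comp v = starRingEnd ℂ c • (pairing ψ).comp v := by
      ext k
      simp only [ContinuousLinearMap.comp_apply, smul_apply, pairing_apply,
        smul_eq_mul]
      rw [← tsum_mul_left]
      exact tsum_congr fun x => by rw [Linf.smul_apply, map_mul]; ring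
    rw [h, map_smulₛₗ]
    simp

lemma inner_adj (v : 𝒦 →L[ℂ] Lone K N s) (ψ : Linf K N s) (k : 𝒦) :
    inner ℂ (adj v ψ) k = ∑' x, starRingEnd ℂ (ψ x) * v k x :=
  InnerProductSpace.toDual_symm_apply

/-- The assumption on the perturbation with parameter `β`: `V` is a bounded self-adjoint operator on
`𝓗`, `v : 𝒦 → 𝓛^β` is bounded and injective, `U` is self-adjoint and unitary on the Hilbert space
`𝒦`, and `V = v U v*` (on `𝓗 ⊆ (𝓛^β)*`). -/
structure Admissible (β : ℕ) (V : Hil K N →L[ℂ] Hil K N) (v : 𝒦 →L[ℂ] Lone K N (β : ℝ))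
    (U : 𝒦 →L[ℂ] 𝒦) : Prop where
  selfAdjoint : IsSelfAdjoint V
  injective : Function.Injective v
  selfAdjoint_U : IsSelfAdjoint U
  unitary_U : U ∈ unitary (𝒦 →L[ℂ] 𝒦)
  factor : ∀ (f : Hil K N) (x : Vtx K N),
    V f x = v (U (adj v (Linf.ofHil (Nat.cast_nonneg β) f))) x

variable (K) in
/-- The function `𝟏^(α)`, equal to `1` on the `α`-th half-line and to `0` elsewhere. -/
def rayOne (α : Fin N) : Vtx K N → ℂ
  | Sum.inl _ => 0
  | Sum.inr (γ, _) => if γ = α then 1 else 0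

/-- `T = ∑_γ |Ψ_γ⟩⟨Ψ_γ|`. -/
def IsSumProj {n : ℕ} (Ψ : Fin n → Vtx K N → ℂ) (T : Bop K N s) : Prop :=
  ∀ (u : Lone K N s) (x : Vtx K N),
    T u x = ∑ γ, Ψ γ x * ∑' y, starRingEnd ℂ (Ψ γ y) * u y

variable [Fintype K]

/-- The operator `H = H₀ + V` on `(𝓛^s)*`, where `V = v U v*` maps `(𝓛^s)*` to `𝓛^s`; the values are
regarded as functions on `G`. -/
def genOp (E₀ : SimpleGraph K) (a : Fin N → K) (v : 𝒦 →L[ℂ] Lone K N s) (U : 𝒦 →L[ℂ] 𝒦) :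
    Linf K N s →ₗ[ℂ] (Vtx K N → ℂ) :=
  freeOp E₀ a ∘ₗ Linf.toFunₗ + Lone.toFunₗ ∘ₗ (v : 𝒦 →ₗ[ℂ] Lone K N s) ∘ₗ (U : 𝒦 →ₗ[ℂ] 𝒦) ∘ₗ adj v

lemma genOp_apply (E₀ : SimpleGraph K) (a : Fin N → K) (v : 𝒦 →L[ℂ] Lone K N s) (U : 𝒦 →L[ℂ] 𝒦)
    (Ψ : Linf K N s) (x : Vtx K N) :
    genOp E₀ a v U Ψ x = freeOp E₀ a Ψ x + v (U (adj v Ψ)) x := rfl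

/-- The generalized zero eigenspace `{Ψ ∈ (𝓛^s)* ; H Ψ = 0}`, as a space of functions on `G`. -/
def genEig (E₀ : SimpleGraph K) (a : Fin N → K) (v : 𝒦 →L[ℂ] Lone K N s) (U : 𝒦 →L[ℂ] 𝒦) :
    Submodule ℂ (Vtx K N → ℂ) :=
  (LinearMap.ker (genOp E₀ a v U)).map Linf.toFunₗ

/-- The space `𝓔` of the generalized eigenfunctions in `ℂ𝟏 ⊕ 𝓛^{β-2}`. -/
def resEig (E₀ : SimpleGraph K) (a : Fin N → K) (v : 𝒦 →L[ℂ] Lone K N s) (U : 𝒦 →L[ℂ] 𝒦) :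
    Submodule ℂ (Vtx K N → ℂ) :=
  genEig E₀ a v U ⊓ (Submodule.span ℂ (Set.range (rayOne K)) ⊔ l1Sub K N (s - 2))

/-- The space `𝖤` of the bound eigenfunctions, those in `𝓛^{β-2}`. -/
def boundEig (E₀ : SimpleGraph K) (a : Fin N → K) (v : 𝒦 →L[ℂ] Lone K N s) (U : 𝒦 →L[ℂ] 𝒦) :
    Submodule ℂ (Vtx K N → ℂ) :=
  genEig E₀ a v U ⊓ l1Sub K N (s - 2)

/-- The threshold `0` is a regular point: `𝓔 = 𝖤 = {0}`. -/
def IsRegularThreshold (E₀ : SimpleGraph K) (a : Fin N → K) (v : 𝒦 →L[ℂ] Lone K N s) (U : 𝒦 →L[ℂ] 𝒦) :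
    Prop :=
  resEig E₀ a v U = ⊥ ∧ boundEig E₀ a v U = ⊥

/-- An orthonormal bound basis: a basis of `𝖤` with `conj Ψ_γ' · Ψ_γ ∈ 𝓛^0` and
`⟨Ψ_γ', Ψ_γ⟩ = δ_{γγ'}`. -/
structure IsBoundBasis (E₀ : SimpleGraph K) (a : Fin N → K) (v : 𝒦 →L[ℂ] Lone K N s)
    (U : 𝒦 →L[ℂ] 𝒦) {n : ℕ} (Ψ : Fin n → Vtx K N → ℂ) : Prop where
  linearIndependent : LinearIndependent ℂ Ψ
  span_eq : Submodule.span ℂ (Set.range Ψ) = boundEig E₀ a v U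
  mem : ∀ γ γ', (fun x => starRingEnd ℂ (Ψ γ' x) * Ψ γ x) ∈ l1Sub K N 0
  inner_eq : ∀ γ γ', ∑' x, starRingEnd ℂ (Ψ γ' x) * Ψ γ x = if γ = γ' then 1 else 0

/-- An orthonormal resonance basis: elements of `𝓔` whose classes form a basis of `𝓔/𝖤`, which are
orthogonal to `𝖤`, and whose leading coefficients form an orthonormal system in `ℂ^N`. -/
structure IsResonanceBasis (E₀ : SimpleGraph K) (a : Fin N → K) (v : 𝒦 →L[ℂ] Lone K N s)
    (U : 𝒦 →L[ℂ] 𝒦) {n : ℕ} (Ψ : Fin n → Vtx K N → ℂ) : Prop where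
  linearIndependent : LinearIndependent ℂ fun γ => (boundEig E₀ a v U).mkQ (Ψ γ)
  span_sup : Submodule.span ℂ (Set.range Ψ) ⊔ boundEig E₀ a v U = resEig E₀ a v U
  mem : ∀ γ, ∀ Φ ∈ boundEig E₀ a v U, (fun x => starRingEnd ℂ (Φ x) * Ψ γ x) ∈ l1Sub K N 0
  inner_eq : ∀ γ, ∀ Φ ∈ boundEig E₀ a v U, ∑' x, starRingEnd ℂ (Φ x) * Ψ γ x = 0
  leading : ∃ c : Fin n → EuclideanSpace ℂ (Fin N), Orthonormal ℂ c ∧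
    ∀ γ, Ψ γ - ∑ α, c γ α • rayOne K α ∈ l1Sub K N (s - 2)

/-- `T` is the orthogonal bound projection `𝖯` (formed with some orthonormal bound basis). -/
def IsBoundProj (E₀ : SimpleGraph K) (a : Fin N → K) (v : 𝒦 →L[ℂ] Lone K N s) (U : 𝒦 →L[ℂ] 𝒦)
    (T : Bop K N s) : Prop :=
  ∃ (n : ℕ) (Ψ : Fin n → Vtx K N → ℂ), IsBoundBasis E₀ a v U Ψ ∧ IsSumProj Ψ T

/-- `T` is the orthogonal resonance projection `𝓟` (formed with some orthonormal resonance
basis). -/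
def IsResonanceProj (E₀ : SimpleGraph K) (a : Fin N → K) (v : 𝒦 →L[ℂ] Lone K N s) (U : 𝒦 →L[ℂ] 𝒦)
    (T : Bop K N s) : Prop :=
  ∃ (n : ℕ) (Ψ : Fin n → Vtx K N → ℂ), IsResonanceBasis E₀ a v U Ψ ∧ IsSumProj Ψ T

/-- The operator `H = H₀ + V` on `𝓗`. -/
def schr (E₀ : SimpleGraph K) (a : Fin N → K) (V : Hil K N →L[ℂ] Hil K N) :
    Hil K N →L[ℂ] Hil K N :=
  freeHil E₀ a + V

/-- The resolvent `R(κ) = (H + κ²)⁻¹`; it is meaningful for `-κ²` in the resolvent set of `H`. -/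
def resolv (E₀ : SimpleGraph K) (a : Fin N → K) (V : Hil K N →L[ℂ] Hil K N) (κ : ℂ) :
    Hil K N →L[ℂ] Hil K N :=
  Ring.inverse (schr E₀ a V + κ ^ 2 • 1)

end Perturbed

end RayGraph

end

open RayGraph Filter Topology Asymptotics

noncomputable section

/-! The free operator decouples into a Dirichlet operator on `K` and `N` Dirichlet half-lines, and
neither kind of block is singular at zero energy. The block on `K` is invertible because `K` is
connected and carries at least one half-line. On a half-line the resolvent kernel is a finite sum of
powers `z ^ p`, where `z + z⁻¹ = 2 + κ²` and `‖z‖ < 1`. The branch `dispersion` of `z` is analytic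
at `κ = 0` with value `1`. Its powers expand in `κ` with coefficients of size `p ^ j` and a
remainder of size `‖κ‖ ^ n * p ^ n` (`exists_expansion_powers`). The weights absorb this growth, and
since operators from `𝓛^s` to its dual are estimated by their kernels, the free resolvent has an
expansion without negative powers (`exists_free_expansion`).

For `V = v U v*` the symmetrized resolvent identity `isUnit_add_and_inverse_eq` gives `R = R₀ - R₀ v
M⁻¹ v* R₀` with `M(κ) = U + v* R₀(κ) v`. Everything therefore rests on the invertibility of `M(0) =
U + v* g₀ v`, with `g₀` the leading coefficient of `R₀` (`isUnit_leading_coeff`). Here `U` is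
invertible and `v* g₀ v` is compact, because `g₀` extends to `𝓛^1` and `𝓛^β ⊆ 𝓛^1` is a norm limit
of finite-rank truncations when `β ≥ 2`. By the Fredholm alternative only injectivity is needed. If
`M(0) φ = 0`, then `Ψ = g₀ v φ` satisfies `H Ψ = 0` because `H₀ g₀ = 1` (`freeOp_coeff_zero`), and
it lies in `ℂ𝟏 ⊕ 𝓛^{β-2}` because the zero-energy half-line kernel becomes constant in its first
argument (`coeff_zero_mem`). Regularity of the threshold forces `Ψ = 0`, hence `v φ = H₀ Ψ = 0` and
`φ = 0`.

Inversion and products of expansions (`HasExpansion.ring_inverse`, `HasExpansion.bilin`) then expand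
`M⁻¹` and `R`. The mapping properties of the coefficients of `R` are inherited from those of `R₀`.
-/

/-- The filter of complex numbers tending to `0` within the open right half-plane. -/
abbrev rightZero : Filter ℂ := 𝓝[{κ : ℂ | 0 < κ.re}] 0

/-! ### Calculus of asymptotic expansions in the right half-plane -/

section Expansion

variable {E F G : Type*} [NormedAddCommGroup E] [NormedSpace ℂ E] [NormedAddCommGroup F]
  [NormedSpace ℂ F] [NormedAddCommGroup G] [NormedSpace ℂ G]

/-- `f κ = ∑_{j < n} κ^j a_j + O(κ^n)` as `κ → 0` in the right half-plane. -/
def HasExpansion (f : ℂ → E) (a : ℕ → E) (n : ℕ) : Prop :=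
  (fun κ => f κ - ∑ j ∈ Finset.range n, κ ^ j • a j) =O[rightZero] fun κ : ℂ => κ ^ n

lemma eventually_re_pos : ∀ᶠ κ in rightZero, 0 < κ.re := self_mem_nhdsWithin

lemma eventually_rightZero_ne : ∀ᶠ κ in rightZero, κ ≠ 0 := by
  filter_upwards [eventually_re_pos] with κ h h0
  simp [h0] at h

lemma tendsto_rightZero : Tendsto (fun κ : ℂ => κ) rightZero (𝓝 0) :=
  tendsto_id.mono_left nhdsWithin_le_nhds

/-- Limits along the filter are then unique, which is how leading coefficients are identified later.
-/
instance rightZero_neBot : NeBot rightZero := by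
  rw [← mem_closure_iff_nhdsWithin_neBot]
  rw [Complex.closure_setOfPred_lt_re]
  simp

lemma isBigO_pow_pow_of_le {m n : ℕ} (h : m ≤ n) :
    (fun κ : ℂ => κ ^ n) =O[rightZero] fun κ : ℂ => κ ^ m := by
  obtain ⟨k, rfl⟩ := Nat.exists_eq_add_of_le h
  have h1 : (fun κ : ℂ => κ ^ k) =O[rightZero] fun _ => (1 : ℂ) :=
    (tendsto_rightZero.pow k).isBigO_one ℂ
  simpa [pow_add] using (isBigO_refl (fun κ : ℂ => κ ^ m) rightZero).mul h1

lemma isBigO_pow_smul_const {m n : ℕ} (h : m ≤ n) (a : E) :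
    (fun κ : ℂ => κ ^ n • a) =O[rightZero] fun κ : ℂ => κ ^ m := by
  have h1 : (fun _ : ℂ => a) =O[rightZero] fun _ => (1 : ℂ) := isBigO_const_const _ one_ne_zero _
  simpa using (isBigO_pow_pow_of_le h).smul h1

lemma isBigO_sum_pow_one (a : ℕ → E) (n : ℕ) :
    (fun κ : ℂ => ∑ j ∈ Finset.range n, κ ^ j • a j) =O[rightZero] fun _ => (1 : ℂ) := by
  refine IsBigO.fun_sum fun j _ => ?_
  simpa using isBigO_pow_smul_const (Nat.zero_le j) (a j)

namespace HasExpansion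

lemma isBigO_one {f : ℂ → E} {a : ℕ → E} {n : ℕ} (h : HasExpansion f a n) :
    f =O[rightZero] fun _ => (1 : ℂ) := by
  have h1 := h.trans (isBigO_pow_pow_of_le (Nat.zero_le n))
  simp only [pow_zero] at h1
  simpa using h1.add (isBigO_sum_pow_one a n)

lemma congr {f g : ℂ → E} {a : ℕ → E} {n : ℕ} (h : HasExpansion f a n)
    (hfg : f =ᶠ[rightZero] g) : HasExpansion g a n :=
  h.congr' (hfg.mono fun κ hκ => by simp only [hκ]) EventuallyEq.rfl

lemma add {f g : ℂ → E} {a b : ℕ → E} {n : ℕ} (hf : HasExpansion f a n)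
    (hg : HasExpansion g b n) : HasExpansion (fun κ => f κ + g κ) (fun j => a j + b j) n := by
  refine (IsBigO.add hf hg).congr_left fun κ => ?_
  simp only [smul_add, Finset.sum_add_distrib]
  abel

lemma sub {f g : ℂ → E} {a b : ℕ → E} {n : ℕ} (hf : HasExpansion f a n)
    (hg : HasExpansion g b n) : HasExpansion (fun κ => f κ - g κ) (fun j => a j - b j) n := by
  refine (IsBigO.sub hf hg).congr_left fun κ => ?_
  simp only [smul_sub, Finset.sum_sub_distrib]
  abel

lemma clm {f : ℂ → E} {a : ℕ → E} {n : ℕ} (hf : HasExpansion f a n) (L : E →L[ℂ] F) :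
    HasExpansion (fun κ => L (f κ)) (fun j => L (a j)) n := by
  refine ((L.isBigO_comp _ _).trans hf).congr_left fun κ => ?_
  simp

lemma const (a : E) (n : ℕ) : HasExpansion (fun _ => a) (fun j => if j = 0 then a else 0) n := by
  rcases n with _ | n
  · simpa only [HasExpansion, Finset.range_zero, Finset.sum_empty, sub_zero, pow_zero, one_smul]
      using isBigO_pow_smul_const (le_refl 0) a
  · refine (isBigO_zero _ _).congr_left fun κ => ?_
    simp

lemma pow_smul_const (a : E) (i n : ℕ) :
    HasExpansion (fun κ => κ ^ i • a) (fun j => if j = i then a else 0) n := by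
  by_cases h : i < n
  · refine (isBigO_zero _ _).congr_left fun κ => ?_
    rw [Finset.sum_eq_single i] <;> simp +contextual [h]
  · refine (isBigO_pow_smul_const (not_lt.1 h) a).congr_left fun κ => ?_
    rw [Finset.sum_eq_zero, sub_zero]
    intro j hj
    have : j ≠ i := by
      rintro rfl
      exact h (Finset.mem_range.1 hj)
    simp [this]

lemma mono {f : ℂ → E} {a : ℕ → E} {m n : ℕ} (hf : HasExpansion f a n) (h : m ≤ n) :
    HasExpansion f a m := by
  obtain ⟨k, rfl⟩ := Nat.exists_eq_add_of_le h
  have h1 : (fun κ : ℂ => ∑ j ∈ Finset.range k, κ ^ (m + j) • a (m + j)) =O[rightZero]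
      fun κ : ℂ => κ ^ m :=
    IsBigO.fun_sum fun j _ => isBigO_pow_smul_const (Nat.le_add_right m j) _
  refine ((hf.trans (isBigO_pow_pow_of_le h)).add h1).congr_left fun κ => ?_
  rw [Finset.sum_range_add]
  abel

lemma tendsto {f : ℂ → E} {a : ℕ → E} {n : ℕ} (hf : HasExpansion f a n) (hn : 0 < n) :
    Tendsto f rightZero (𝓝 (a 0)) := by
  have h1 := hf.mono (Nat.succ_le_of_lt hn)
  simp only [HasExpansion, Finset.range_one, Finset.sum_singleton, pow_zero, one_smul,
    Nat.succ_eq_add_one, zero_add, pow_one] at h1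
  have h2 := (h1.trans_tendsto tendsto_rightZero).add_const (a 0)
  simpa using h2

lemma shift {f : ℂ → E} {a : ℕ → E} {n : ℕ} (hf : HasExpansion f a n) :
    HasExpansion (fun κ => κ • f κ) (fun j => if j = 0 then 0 else a (j - 1)) (n + 1) := by
  refine ((isBigO_refl (fun κ : ℂ => κ) rightZero).smul hf).congr (fun κ => ?_) fun κ => ?_
  · rw [Finset.sum_range_succ', smul_sub, Finset.smul_sum]
    simp [pow_succ', mul_smul]
  · simp [pow_succ']

lemma unshift {f : ℂ → E} {a : ℕ → E} {n : ℕ} (hf : HasExpansion f a (n + 1)) :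
    HasExpansion (fun κ => κ⁻¹ • (f κ - a 0)) (fun j => a (j + 1)) n := by
  refine ((isBigO_refl (fun κ : ℂ => κ⁻¹) rightZero).smul hf).congr' ?_ ?_
  · filter_upwards [eventually_rightZero_ne] with κ hκ
    rw [Finset.sum_range_succ']
    simp only [smul_sub, smul_add, Finset.smul_sum, pow_zero, one_smul]
    have : ∀ j, κ⁻¹ • κ ^ (j + 1) • a (j + 1) = κ ^ j • a (j + 1) := fun j => by
      rw [smul_smul, pow_succ', inv_mul_cancel_left₀ hκ]
    simp only [this]
    abel
  · filter_upwards [eventually_rightZero_ne] with κ hκ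
    rw [smul_eq_mul, pow_succ', inv_mul_cancel_left₀ hκ]

/-- The Cauchy product. With truncations `A` of `f` and `B'` of `g`, the splitting `B(f, g) - B(A,
B') = B(f - A, g) + B(A, g - B')` puts one remainder in each term, next to a bounded factor. -/
lemma bilin {f : ℂ → E} {g : ℂ → F} {a : ℕ → E} {b : ℕ → F} {n : ℕ} (hf : HasExpansion f a n)
    (hg : HasExpansion g b n) (B : E →L[ℂ] F →L[ℂ] G) :
    HasExpansion (fun κ => B (f κ) (g κ))
      (fun j => ∑ p ∈ Finset.HasAntidiagonal.antidiagonal j, B (a p.1) (b p.2)) n := by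
  have hB : ∀ {f : ℂ → E} {g : ℂ → F} {p q : ℂ → ℂ}, f =O[rightZero] p → g =O[rightZero] q →
      (fun κ => B (f κ) (g κ)) =O[rightZero] fun κ => p κ * q κ := fun {f g p q} hp hq => by
    have h1 : (fun κ => B (f κ) (g κ)) =O[rightZero] fun κ => ‖f κ‖ * ‖g κ‖ :=
      IsBigO.of_bound ‖B‖ (Eventually.of_forall fun κ => by
        simpa [mul_assoc] using B.le_opNorm₂ (f κ) (g κ))
    refine (h1.trans (hp.norm_norm.mul hq.norm_norm)).trans ?_
    simp only [← norm_mul]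
    exact (isBigO_refl _ _).norm_left
  have h1 := hB hf hg.isBigO_one
  have h2 := hB (isBigO_sum_pow_one a n) hg
  -- The product of the two truncations also contains terms of degree at least `n`; these belong to
  -- the remainder.
  have h3 : (fun κ : ℂ => ∑ p ∈ Finset.range n, ∑ i ∈ Finset.range p,
      κ ^ (n + i) • B (a p) (b (n - p + i))) =O[rightZero] fun κ : ℂ => κ ^ n :=
    IsBigO.fun_sum fun p _ => IsBigO.fun_sum fun i _ => isBigO_pow_smul_const (Nat.le_add_right n i) _
  simp only [mul_one, one_mul] at h1 h2
  refine ((h1.add h2).add h3).congr_left fun κ => ?_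
  have h4 : ∑ j ∈ Finset.range n, κ ^ j • ∑ p ∈ Finset.HasAntidiagonal.antidiagonal j, B (a p.1) (b p.2)
      = ∑ p ∈ Finset.range n, ∑ q ∈ Finset.range (n - p), (κ ^ p * κ ^ q) • B (a p) (b q) := by
    rw [← Finset.sum_range_diag_flip]
    refine Finset.sum_congr rfl fun j _ => ?_
    rw [Finset.Nat.sum_antidiagonal_eq_sum_range_succ_mk, Finset.smul_sum]
    refine Finset.sum_congr rfl fun p hp => ?_
    rw [← pow_add, Nat.add_sub_cancel' (Nat.lt_succ_iff.1 (Finset.mem_range.1 hp))]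
  have h5 : B (∑ j ∈ Finset.range n, κ ^ j • a j) (∑ j ∈ Finset.range n, κ ^ j • b j)
      = ∑ p ∈ Finset.range n, ∑ q ∈ Finset.range (n - p), (κ ^ p * κ ^ q) • B (a p) (b q)
        + ∑ p ∈ Finset.range n, ∑ i ∈ Finset.range p, κ ^ (n + i) • B (a p) (b (n - p + i)) := by
    rw [← Finset.sum_add_distrib]
    simp only [map_sum, sum_apply, map_smul, smul_apply, Finset.smul_sum]
    rw [Finset.sum_comm]
    refine Finset.sum_congr rfl fun p hp => ?_
    have hp' := (Finset.mem_range.1 hp).le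
    have : ∑ q ∈ Finset.range n, κ ^ q • κ ^ p • B (a p) (b q)
      = ∑ q ∈ Finset.range (n - p + p), κ ^ q • κ ^ p • B (a p) (b q) := by
      rw [Nat.sub_add_cancel hp']
    rw [this, Finset.sum_range_add]
    congr 1
    · exact Finset.sum_congr rfl fun q _ => by rw [smul_smul, mul_comm]
    · refine Finset.sum_congr rfl fun i _ => ?_
      rw [smul_smul, ← pow_add]
      congr 2
      omega
  rw [h4]
  rw [eq_sub_of_add_eq' h5.symm]
  simp only [map_sub, sub_apply]
  abel

/-- Induction on the order through `f⁻¹ = a₀⁻¹ - κ a₀⁻¹ ((f - a₀) / κ) f⁻¹`: the factor `κ` turns an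
expansion of `f⁻¹` to order `m` on the right into one to order `m + 1` on the left. Continuity of
inversion at `a₀` gives the boundedness that starts the induction. -/
lemma ring_inverse {A : Type*} [NormedRing A] [NormedAlgebra ℂ A] [CompleteSpace A] {f : ℂ → A}
    {a : ℕ → A} (n : ℕ) (hf : HasExpansion f a (n + 1)) (h0 : IsUnit (a 0)) :
    ∃ b : ℕ → A, HasExpansion (fun κ => Ring.inverse (f κ)) b (n + 1) := by
  have ht := hf.tendsto n.succ_pos
  have hu : ∀ᶠ κ in rightZero, IsUnit (f κ) := ht.eventually (Units.isOpen.mem_nhds h0)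
  have hc : Tendsto (fun κ => Ring.inverse (f κ)) rightZero (𝓝 (Ring.inverse (a 0))) := by
    obtain ⟨x, hx⟩ := h0
    rw [← hx] at ht ⊢
    exact (NormedRing.inverse_continuousAt x).tendsto.comp ht
  have key : ∀ m ≤ n + 1, ∃ b : ℕ → A, HasExpansion (fun κ => Ring.inverse (f κ)) b m := by
    intro m
    induction m with
    | zero =>
      intro _
      refine ⟨0, ?_⟩
      simpa [HasExpansion] using hc.isBigO_one ℂ
    | succ m ih =>
      intro hm
      obtain ⟨b, hb⟩ := ih (by omega)
      have h1 := (hf.mono hm).unshift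
      have h2 := ((h1.bilin hb (ContinuousLinearMap.mul ℂ A)).clm
        (ContinuousLinearMap.mul ℂ A (Ring.inverse (a 0)))).shift
      refine ⟨_, ((const (Ring.inverse (a 0)) (m + 1)).sub h2).congr ?_⟩
      filter_upwards [eventually_rightZero_ne, hu] with κ hκ hκu
      simp only [ContinuousLinearMap.mul_apply', smul_mul_assoc, mul_smul_comm, smul_smul,
        mul_inv_cancel₀ hκ, one_smul]
      rw [sub_mul, mul_sub, ← mul_assoc _ (a 0), Ring.mul_inverse_cancel _ hκu,
        Ring.inverse_mul_cancel _ h0]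
      simp
  exact key _ le_rfl

/-- The Taylor expansion of a function that is analytic at `0`. -/
lemma of_analyticAt [CompleteSpace E] {f : ℂ → E} (hf : AnalyticAt ℂ f 0) (n : ℕ) :
    ∃ a : ℕ → E, HasExpansion f a n ∧ a 0 = f 0 := by
  obtain ⟨p, hp⟩ := hf
  refine ⟨p.coeff, ?_, ?_⟩
  · have h := (hp.isBigO_sub_partialSum_pow n).mono (nhdsWithin_le_nhds (s := {κ : ℂ | 0 < κ.re}))
    simp only [← norm_pow] at h
    refine h.of_norm_right.congr_left fun κ => ?_
    · simp only [zero_add, FormalMultilinearSeries.partialSum,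
        FormalMultilinearSeries.apply_eq_pow_smul_coeff]
  · simpa using hp.coeff_zero (fun _ => 1)

end HasExpansion
end Expansion

/-! ### Monotonicity and comparison of weights -/

section Weights

variable {K : Type*} {N : ℕ}

lemma wt_mono {s t : ℝ} (h : s ≤ t) (x : Vtx K N) : wt s x ≤ wt t x := by
  rcases x with x | ⟨α, n⟩
  · exact le_rfl
  · exact Real.rpow_le_rpow_of_exponent_le (by nlinarith [sq_nonneg ((n : ℝ) + 1)]) (by linarith)

lemma wt_add (s t : ℝ) (x : Vtx K N) : wt (s + t) x = wt s x * wt t x := by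
  rcases x with x | ⟨α, n⟩
  · simp [wt]
  · simp only [wt]
    rw [add_div, Real.rpow_add (by positivity)]

lemma pow_le_wt (p : ℕ) (α : Fin N) (n : ℕ) :
    ((n : ℝ) + 1) ^ p ≤ wt (p : ℝ) (Sum.inr (α, n) : Vtx K N) := by
  have h : ((n : ℝ) + 1) ^ p = (((n : ℝ) + 1) ^ 2) ^ ((p : ℝ) / 2) := by
    rw [← Real.rpow_natCast, ← Real.rpow_natCast, ← Real.rpow_mul (by positivity)]
    congr 1
    push_cast
    ring
  rw [h]
  exact Real.rpow_le_rpow (by positivity) (by linarith) (by positivity)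

lemma wt_ray_mono {s : ℝ} (hs : 0 ≤ s) (α : Fin N) {m n : ℕ} (h : m ≤ n) :
    wt s (Sum.inr (α, m) : Vtx K N) ≤ wt s (Sum.inr (α, n) : Vtx K N) := by
  have : (m : ℝ) ≤ n := by exact_mod_cast h
  exact Real.rpow_le_rpow (by positivity) (by gcongr) (by positivity)

end Weights

/-! ### Embeddings, operators with kernels, and extension to larger spaces -/

section Operators

variable {K : Type*} {N : ℕ} {s t : ℝ}

/-- The embedding `𝓛^t ⊆ 𝓛^s` for `s ≤ t`. -/
def Lone.incl (h : s ≤ t) : Lone K N t →L[ℂ] Lone K N s :=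
  have key : ∀ (u : Lone K N t) (x : Vtx K N), wt s x * ‖u x‖ ≤ wt t x * ‖u x‖ := fun u x =>
    mul_le_mul_of_nonneg_right (wt_mono h x) (norm_nonneg _)
  have summ : ∀ u : Lone K N t, Summable fun x => wt s x * ‖u x‖ := fun u =>
    Summable.of_nonneg_of_le (fun x => mul_nonneg (wt_pos s x).le (norm_nonneg _)) (key u)
      u.summable
  LinearMap.mkContinuous
    { toFun := fun u => ⟨u.1, summ u⟩
      map_add' := fun _ _ => rfl
      map_smul' := fun _ _ => rfl } 1 fun u => by
    rw [one_mul]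
    exact Summable.tsum_le_tsum (key u) (summ u) u.summable

lemma Lone.incl_apply (h : s ≤ t) (u : Lone K N t) (x : Vtx K N) : Lone.incl h u x = u x := rfl

/-- The embedding `(𝓛^s)* ⊆ (𝓛^t)*` for `s ≤ t`. -/
def Linf.incl (h : s ≤ t) : Linf K N s →L[ℂ] Linf K N t :=
  have key : ∀ (u : Linf K N s) (x : Vtx K N), wt (-t) x * ‖u x‖ ≤ ‖u‖ := fun u x =>
    (mul_le_mul_of_nonneg_right (wt_mono (neg_le_neg h) x) (norm_nonneg _)).trans (u.le_norm x)
  LinearMap.mkContinuous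
    { toFun := fun u => ⟨u.1, ⟨‖u‖, by rintro _ ⟨x, rfl⟩; exact key u x⟩⟩
      map_add' := fun _ _ => rfl
      map_smul' := fun _ _ => rfl } 1 fun u => by
    rw [one_mul]
    exact Linf.norm_le _ (norm_nonneg u) (key u)

lemma Linf.incl_apply (h : s ≤ t) (u : Linf K N s) (x : Vtx K N) : Linf.incl h u x = u x := rfl

lemma Lone.ext_apply {u w : Lone K N s} (h : ∀ x, u x = w x) : u = w := Subtype.ext (funext h)

lemma Linf.ext_apply {u w : Linf K N s} (h : ∀ x, u x = w x) : u = w := Subtype.ext (funext h)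

lemma Linf.continuous_apply (x : Vtx K N) : Continuous fun u : Linf K N s => u x := by
  have h : LipschitzWith (Real.toNNReal (wt s x)) fun u : Linf K N s => u x := by
    refine LipschitzWith.of_dist_le_mul fun u w => ?_
    rw [dist_eq_norm, dist_eq_norm, Real.coe_toNNReal _ (wt_pos s x).le]
    have h1 := (u - w).le_norm x
    have h2 := mul_le_mul_of_nonneg_left h1 (wt_pos s x).le
    rwa [← mul_assoc, mul_comm (wt s x), wt_neg_mul, one_mul] at h2
  exact h.continuous

/-- `T` is the operator with the kernel `k`. -/
def HasKernel (T : Bop K N s) (k : Vtx K N → Vtx K N → ℂ) : Prop :=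
  ∀ (u : Lone K N s) (x : Vtx K N), HasSum (fun y => k x y * u y) (T u x)

namespace HasKernel

lemma sub {T S : Bop K N s} {k l : Vtx K N → Vtx K N → ℂ} (hT : HasKernel T k)
    (hS : HasKernel S l) : HasKernel (T - S) fun x y => k x y - l x y := fun u x => by
  simp only [sub_mul]
  exact (hT u x).sub (hS u x)

lemma sum_smul {ι : Type*} {T : ι → Bop K N s} {k : ι → Vtx K N → Vtx K N → ℂ} (F : Finset ι)
    (c : ι → ℂ) (h : ∀ j ∈ F, HasKernel (T j) (k j)) :
    HasKernel (∑ j ∈ F, c j • T j) fun x y => ∑ j ∈ F, c j * k j x y := fun u x => by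
  have e : (∑ j ∈ F, c j • T j) u x = ∑ j ∈ F, c j * T j u x := by
    have := map_sum (LinearMap.proj x ∘ₗ Linf.toFunₗ ∘ₗ
      (ContinuousLinearMap.apply ℂ (Linf K N s) u).toLinearMap) (fun j => c j • T j) F
    exact this
  rw [e]
  simp only [Finset.sum_mul, mul_assoc]
  exact hasSum_sum fun j hj => (h j hj u x).mul_left (c j)

lemma bound_apply {k : Vtx K N → Vtx K N → ℂ} {C : ℝ}
    (hk : ∀ x y, ‖k x y‖ ≤ C * (wt s x * wt s y)) (u : Lone K N s) (x y : Vtx K N) :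
    ‖k x y * u y‖ ≤ C * wt s x * (wt s y * ‖u y‖) := by
  rw [norm_mul]
  calc ‖k x y‖ * ‖u y‖ ≤ C * (wt s x * wt s y) * ‖u y‖ :=
        mul_le_mul_of_nonneg_right (hk x y) (norm_nonneg _)
    _ = _ := by ring

/-- From a weighted `ℓ¹` to a weighted `ℓ^∞`, a pointwise kernel bound is already an operator bound,
with no Schur-type summation. -/
lemma norm_le {T : Bop K N s} {k : Vtx K N → Vtx K N → ℂ} (hT : HasKernel T k) {C : ℝ}
    (hC : 0 ≤ C) (hk : ∀ x y, ‖k x y‖ ≤ C * (wt s x * wt s y)) : ‖T‖ ≤ C := by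
  refine T.opNorm_le_bound hC fun u => Linf.norm_le _ (by positivity) fun x => ?_
  have h1 := tsum_of_norm_bounded (u.summable.mul_left (C * wt s x)).hasSum (bound_apply hk u x)
  rw [(hT u x).tsum_eq, tsum_mul_left, ← Lone.norm_def] at h1
  calc wt (-s) x * ‖T u x‖ ≤ wt (-s) x * (C * wt s x * ‖u‖) :=
        mul_le_mul_of_nonneg_left h1 (wt_pos _ x).le
    _ = (wt (-s) x * wt s x) * (C * ‖u‖) := by ring
    _ = C * ‖u‖ := by rw [wt_neg_mul, one_mul]

lemma exists_of_bound (k : Vtx K N → Vtx K N → ℂ) {C : ℝ} (hC : 0 ≤ C)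
    (hk : ∀ x y, ‖k x y‖ ≤ C * (wt s x * wt s y)) : ∃ T : Bop K N s, HasKernel T k := by
  have hs : ∀ (u : Lone K N s) (x : Vtx K N), Summable fun y => k x y * u y := fun u x =>
    Summable.of_norm_bounded (u.summable.mul_left _) (bound_apply hk u x)
  have hb : ∀ (u : Lone K N s) (x : Vtx K N), wt (-s) x * ‖∑' y, k x y * u y‖ ≤ C * ‖u‖ := by
    intro u x
    have h1 := tsum_of_norm_bounded (u.summable.mul_left (C * wt s x)).hasSum (bound_apply hk u x)
    rw [tsum_mul_left, ← Lone.norm_def] at h1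
    calc wt (-s) x * ‖∑' y, k x y * u y‖ ≤ wt (-s) x * (C * wt s x * ‖u‖) :=
          mul_le_mul_of_nonneg_left h1 (wt_pos _ x).le
      _ = (wt (-s) x * wt s x) * (C * ‖u‖) := by ring
      _ = C * ‖u‖ := by rw [wt_neg_mul, one_mul]
  refine ⟨LinearMap.mkContinuous
    { toFun := fun u => ⟨fun x => ∑' y, k x y * u y,
        ⟨C * ‖u‖, by rintro _ ⟨x, rfl⟩; exact hb u x⟩⟩
      map_add' := fun u w => Linf.ext_apply fun x => ?_
      map_smul' := fun c u => Linf.ext_apply fun x => ?_ } C fun u =>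
        Linf.norm_le _ (by positivity) (hb u), fun u x => (hs u x).hasSum⟩
  · change ∑' y, k x y * (u + w) y = ∑' y, k x y * u y + ∑' y, k x y * w y
    rw [← (hs u x).tsum_add (hs w x)]
    exact tsum_congr fun y => by rw [Lone.add_apply, mul_add]
  · change ∑' y, k x y * (c • u) y = c * ∑' y, k x y * u y
    rw [← tsum_mul_left]
    exact tsum_congr fun y => by rw [Lone.smul_apply]; ring

/-- The kernel does not depend on the space on which the operator acts, so a bound with the weight
of order `s` defines the extension directly. -/
lemma memB {T : Bop K N t} {k : Vtx K N → Vtx K N → ℂ} (hT : HasKernel T k) {C : ℝ} (hC : 0 ≤ C)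
    (hk : ∀ x y, ‖k x y‖ ≤ C * (wt s x * wt s y)) : T.MemB s := by
  obtain ⟨S, hS⟩ := exists_of_bound k hC hk
  refine ⟨S, fun u w h x => ?_⟩
  have h1 := hS u x
  simp only [h] at h1
  exact h1.unique (hT w x)

end HasKernel

lemma RayGraph.Bop.MemB.mono {T : Bop K N t} {r : ℝ} (h : T.MemB r) (hrs : r ≤ s) : T.MemB s := by
  obtain ⟨S, hS⟩ := h
  exact ⟨(Linf.incl hrs).comp (S.comp (Lone.incl hrs)), fun u w huw x =>
    hS (Lone.incl hrs u) w huw x⟩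

lemma RayGraph.Bop.MemB.sub {T S : Bop K N t} (hT : T.MemB s) (hS : S.MemB s) :
    (T - S).MemB s := by
  obtain ⟨T', hT'⟩ := hT
  obtain ⟨S', hS'⟩ := hS
  refine ⟨T' - S', fun u w h x => ?_⟩
  exact congrArg₂ (· - ·) (hT' u w h x) (hS' u w h x)

lemma RayGraph.Bop.MemB.sum {ι : Type*} {T : ι → Bop K N t} (F : Finset ι)
    (h : ∀ i ∈ F, (T i).MemB s) : (∑ i ∈ F, T i).MemB s := by
  classical
  induction F using Finset.induction_on with
  | empty => exact ⟨0, fun u w _ x => rfl⟩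
  | insert i F hi ih =>
    obtain ⟨T', hT'⟩ := h i (Finset.mem_insert_self i F)
    obtain ⟨S', hS'⟩ := ih fun j hj => h j (Finset.mem_insert_of_mem hj)
    refine ⟨T' + S', fun u w h x => ?_⟩
    rw [Finset.sum_insert hi]
    exact congrArg₂ (· + ·) (hT' u w h x) (hS' u w h x)

/-- No extension of `W` is needed: the extension of `S` lands in `(𝓛^s)* ⊆ (𝓛^t)*`, then `W` lands
in `𝓛^t ⊆ 𝓛^s`, where the extension of `T` takes over. -/
lemma RayGraph.Bop.MemB.comp {T S : Bop K N t} (hst : s ≤ t) (hT : T.MemB s) (hS : S.MemB s)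
    (W : Linf K N t →L[ℂ] Lone K N t) : Bop.MemB (T.comp (W.comp S)) s := by
  obtain ⟨T', hT'⟩ := hT
  obtain ⟨S', hS'⟩ := hS
  refine ⟨T'.comp ((Lone.incl hst).comp (W.comp ((Linf.incl hst).comp S'))), fun u w h x => ?_⟩
  refine hT' _ _ (fun y => ?_) x
  have e : Linf.incl hst (S' u) = S w := Linf.ext_apply fun z => hS' u w h z
  exact congrArg (fun ψ => W ψ y) e

variable {𝒦 : Type*} [NormedAddCommGroup 𝒦] [InnerProductSpace ℂ 𝒦] [CompleteSpace 𝒦]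

/-- The adjoint `v*` as a bounded operator. -/
def adjL (v : 𝒦 →L[ℂ] Lone K N s) : Linf K N s →L[ℂ] 𝒦 :=
  LinearMap.mkContinuous (adj v) ‖v‖ fun ψ => by
    have h1 : ‖pairing ψ‖ ≤ ‖ψ‖ := LinearMap.mkContinuous_norm_le _ (norm_nonneg _) _
    calc ‖adj v ψ‖ = ‖(pairing ψ).comp v‖ := (InnerProductSpace.toDual ℂ 𝒦).symm.norm_map _
      _ ≤ ‖pairing ψ‖ * ‖v‖ := ContinuousLinearMap.opNorm_comp_le _ _
      _ ≤ ‖ψ‖ * ‖v‖ := mul_le_mul_of_nonneg_right h1 (norm_nonneg _)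
      _ = ‖v‖ * ‖ψ‖ := mul_comm _ _

end Operators

/-! ### Summation over the finite part and the half-lines -/

section VertexSums

variable {K : Type*} {N : ℕ} [Fintype K]

lemma hasSum_vtx {E : Type*} [AddCommMonoid E] [TopologicalSpace E] [ContinuousAdd E]
    {f : Vtx K N → E} {S : Fin N → E}
    (h : ∀ α, HasSum (fun n => f (Sum.inr (α, n))) (S α)) :
    HasSum f (∑ x, f (Sum.inl x) + ∑ α, S α) := by
  classical
  have h1 : HasSum (Sum.elim (fun x => f (Sum.inl x)) fun _ => 0 : Vtx K N → E)
      (∑ x, f (Sum.inl x)) := by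
    refine (Sum.inl_injective.hasSum_iff ?_).1 (hasSum_fintype fun x => f (Sum.inl x))
    rintro (x | p) hx
    · exact absurd ⟨x, rfl⟩ hx
    · rfl
  have h2 : ∀ α, HasSum (fun z : Vtx K N => Sum.elim (fun _ => 0)
      (fun p : Fin N × ℕ => if p.1 = α then f (Sum.inr p) else 0) z) (S α) := by
    intro α
    have hi : Function.Injective fun n : ℕ => (Sum.inr (α, n) : Vtx K N) := by
      intro m n hmn
      simpa using hmn
    refine (hi.hasSum_iff ?_).1 ?_
    · rintro (x | ⟨γ, n⟩) hx
      · rfl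
      · have : γ ≠ α := by
          rintro rfl
          exact hx ⟨n, rfl⟩
        simp [this]
    · simpa [Function.comp_def] using h α
  have h3 := h1.add (hasSum_sum (s := Finset.univ) fun α _ => h2 α)
  convert h3 using 1
  funext z
  rcases z with x | ⟨γ, n⟩ <;> simp

lemma summable_vtx {f : Vtx K N → ℝ} (h : ∀ α, Summable fun n => f (Sum.inr (α, n))) :
    Summable f :=
  (hasSum_vtx fun α => (h α).hasSum).summable

end VertexSums

/-! ### Positivity of the free operator and invertibility of its blocks -/

section Positivity

open scoped ComplexOrder

variable {K : Type*} {N : ℕ} [Fintype K] (E₀ : SimpleGraph K) (a : Fin N → K)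

open Classical in
-- Symmetrization over ordered pairs: exchanging `x` and `y` in the edge sum and adding turns `conj
-- u(x) (u(x) - u(y))` into `|u(x) - u(y)|²`. This is the origin of the factor `2`.
lemma sum_conj_mul_freeOp (u : Vtx K N → ℂ) :
    2 * ∑ x, starRingEnd ℂ (u (Sum.inl x)) * freeOp E₀ a u (Sum.inl x)
      = (∑ x, ∑ y, if E₀.Adj x y then ((‖u (Sum.inl x) - u (Sum.inl y)‖ ^ 2 : ℝ) : ℂ) else 0)
        + 2 * ∑ α, ((‖u (Sum.inl (a α))‖ ^ 2 : ℝ) : ℂ) := by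
  have hs : ∀ z : ℂ, ((‖z‖ ^ 2 : ℝ) : ℂ) = starRingEnd ℂ z * z := fun z => by
    rw [mul_comm, Complex.mul_conj, Complex.normSq_eq_norm_sq]
  have e1 : ∑ x, starRingEnd ℂ (u (Sum.inl x)) * freeOp E₀ a u (Sum.inl x)
      = (∑ x, ∑ y, if E₀.Adj x y then
          starRingEnd ℂ (u (Sum.inl x)) * (u (Sum.inl x) - u (Sum.inl y)) else 0)
        + ∑ α, ((‖u (Sum.inl (a α))‖ ^ 2 : ℝ) : ℂ) := by
    simp only [freeOp, LinearMap.coe_mk, AddHom.coe_mk, mul_add, Finset.mul_sum,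
      Finset.sum_add_distrib, mul_ite, mul_zero, hs]
    congr 1
    rw [Finset.sum_comm]
    simp
  have e2 : (∑ x, ∑ y, if E₀.Adj x y then
          starRingEnd ℂ (u (Sum.inl x)) * (u (Sum.inl x) - u (Sum.inl y)) else 0)
      = ∑ x, ∑ y, if E₀.Adj x y then
          starRingEnd ℂ (u (Sum.inl y)) * (u (Sum.inl y) - u (Sum.inl x)) else 0 := by
    rw [Finset.sum_comm]
    simp only [E₀.adj_comm]
  have e3 : (∑ x, ∑ y, if E₀.Adj x y then ((‖u (Sum.inl x) - u (Sum.inl y)‖ ^ 2 : ℝ) : ℂ) else 0)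
      = (∑ x, ∑ y, if E₀.Adj x y then
          starRingEnd ℂ (u (Sum.inl x)) * (u (Sum.inl x) - u (Sum.inl y)) else 0)
        + ∑ x, ∑ y, if E₀.Adj x y then
          starRingEnd ℂ (u (Sum.inl y)) * (u (Sum.inl y) - u (Sum.inl x)) else 0 := by
    simp only [← Finset.sum_add_distrib]
    refine Finset.sum_congr rfl fun x _ => Finset.sum_congr rfl fun y _ => ?_
    split_ifs
    · rw [hs, map_sub]; ring
    · simp
  rw [e1, e3, ← e2]
  ring

/-- Summation by parts: a partial sum minus the boundary term at its end equals `|u₀|²` plus a sum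
of squared differences, and the boundary term tends to `0`. -/
lemma ray_form_nonneg {f : Vtx K N → ℂ} (α : Fin N)
    (hf : Tendsto (fun n => f (Sum.inr (α, n))) atTop (𝓝 0)) {S : ℂ}
    (hS : HasSum (fun n => starRingEnd ℂ (f (Sum.inr (α, n))) * freeOp E₀ a f (Sum.inr (α, n))) S) :
    0 ≤ S := by
  set u : ℕ → ℂ := fun n => f (Sum.inr (α, n)) with hu
  have hp : ∀ M : ℕ, 0 ≤ ∑ n ∈ Finset.range (M + 1),
      starRingEnd ℂ (u n) * freeOp E₀ a f (Sum.inr (α, n))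
        - starRingEnd ℂ (u M) * (u M - u (M + 1)) := by
    intro M
    induction M with
    | zero =>
      have : freeOp E₀ a f (Sum.inr (α, 0)) = 2 * u 0 - u 1 := rfl
      simp only [zero_add, Finset.sum_range_one, this]
      have e : starRingEnd ℂ (u 0) * (2 * u 0 - u 1) - starRingEnd ℂ (u 0) * (u 0 - u 1)
          = star (u 0) * u 0 := by
        simp only [starRingEnd_apply]; ring
      rw [e]
      exact star_mul_self_nonneg _
    | succ M ih =>
      have : freeOp E₀ a f (Sum.inr (α, M + 1)) = 2 * u (M + 1) - u (M + 2) - u M := rfl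
      rw [Finset.sum_range_succ, this]
      have h2 := add_nonneg ih (star_mul_self_nonneg (u (M + 1) - u M))
      convert h2 using 1
      simp only [starRingEnd_apply, star_sub]
      ring
  have h1 := hS.tendsto_sum_nat.comp (tendsto_add_atTop_nat 1)
  have h2 : Tendsto (fun M => starRingEnd ℂ (u M) * (u M - u (M + 1))) atTop (𝓝 0) := by
    have h3 := (Complex.continuous_conj.tendsto 0).comp hf
    have h4 := hf.sub (hf.comp (tendsto_add_atTop_nat 1))
    simpa using h3.mul h4
  have h3 := h1.sub h2
  rw [sub_zero] at h3
  exact ge_of_tendsto' h3 hp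

/-- In the order of `ℂ` the inequality also says that the form is real; both facts are used in the
coercivity estimate. -/
lemma inner_freeHil_nonneg (f : Hil K N) : 0 ≤ inner ℂ f (freeHil E₀ a f) := by
  classical
  have h1 := lp.hasSum_inner (𝕜 := ℂ) f (freeHil E₀ a f)
  simp only [freeHil_apply, RCLike.inner_apply', starRingEnd_apply] at h1
  have hray : ∀ α, Summable fun n : ℕ =>
      star (f (Sum.inr (α, n))) * freeOp E₀ a f (Sum.inr (α, n)) := fun α =>
    h1.summable.comp_injective (i := fun n : ℕ => (Sum.inr (α, n) : Vtx K N)) fun m n hmn => by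
      simpa using hmn
  rw [h1.unique (hasSum_vtx fun α => (hray α).hasSum)]
  refine add_nonneg ?_ (Finset.sum_nonneg fun α _ => ?_)
  · have h2 := sum_conj_mul_freeOp E₀ a (f : Vtx K N → ℂ)
    have h3 : 0 ≤ 2 * ∑ x, starRingEnd ℂ (f (Sum.inl x)) * freeOp E₀ a f (Sum.inl x) := by
      rw [h2]
      refine add_nonneg (Finset.sum_nonneg fun x _ => Finset.sum_nonneg fun y _ => ?_)
        (mul_nonneg (by norm_num) (Finset.sum_nonneg fun α _ => ?_))
      · split_ifs
        · exact Complex.zero_le_real.2 (by positivity)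
        · exact le_rfl
      · exact Complex.zero_le_real.2 (by positivity)
    simp only [← starRingEnd_apply]
    revert h3
    generalize ∑ x, starRingEnd ℂ (f (Sum.inl x)) * freeOp E₀ a f (Sum.inl x) = T
    simp only [Complex.nonneg_iff, Complex.mul_re, Complex.mul_im, Complex.re_ofNat,
      Complex.im_ofNat, zero_mul, sub_zero, add_zero]
    rintro ⟨hr, hi⟩
    constructor <;> linarith
  · have hsq : Summable fun n : ℕ => ‖f (Sum.inr (α, n))‖ ^ 2 := by
      have : Summable fun x => ‖f x‖ ^ 2 := by
        simpa using (lp.memℓp f).summable (by norm_num)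
      exact this.comp_injective (i := fun n : ℕ => (Sum.inr (α, n) : Vtx K N)) fun m n hmn => by
        simpa using hmn
    refine ray_form_nonneg E₀ a α ?_ (hray α).hasSum
    rw [tendsto_zero_iff_norm_tendsto_zero]
    have h2 := (Real.continuous_sqrt.tendsto 0).comp hsq.tendsto_atTop_zero
    simpa [Function.comp_def, Real.sqrt_sq] using h2

/-- Coercivity after rotation by `conj κ`: with `r = ⟨x, H₀ x⟩ ≥ 0`, the real part of `conj κ (r +
κ² ‖x‖²)` is `Re κ (r + |κ|² ‖x‖²)`. Dividing by `|κ|` gives the constant `Re κ · |κ|`, and no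
spectral calculus is needed. -/
lemma isUnit_freeHil_add {κ : ℂ} (hκ : 0 < κ.re) : IsUnit (freeHil E₀ a + κ ^ 2 • 1) := by
  have hκ0 : 0 < ‖κ‖ := norm_pos_iff.2 fun h => by simp [h] at hκ
  refine ContinuousLinearMap.isUnit_of_forall_le_norm_inner_map _ (c := ⟨κ.re * ‖κ‖, by positivity⟩)
    (by exact mul_pos hκ hκ0) fun x => ?_
  obtain ⟨hr, hi⟩ := Complex.nonneg_iff.1 (inner_freeHil_nonneg E₀ a x)
  have e : inner ℂ x ((freeHil E₀ a + κ ^ 2 • 1) x)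
      = ((inner ℂ x (freeHil E₀ a x)).re : ℂ) + κ ^ 2 * ((‖x‖ ^ 2 : ℝ) : ℂ) := by
    rw [add_apply, inner_add_right, smul_apply, one_apply_eq_self, inner_smul_right,
      inner_self_eq_norm_sq_to_K]
    congr 1
    · exact Complex.ext (by simp) (by simp [← hi])
    · simp
  rw [norm_inner_symm, e]
  set r := (inner ℂ x (freeHil E₀ a x)).re
  have h1 := Complex.re_le_norm (starRingEnd ℂ κ * ((r : ℂ) + κ ^ 2 * ((‖x‖ ^ 2 : ℝ) : ℂ)))
  rw [norm_mul, RCLike.norm_conj] at h1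
  have h2 : (starRingEnd ℂ κ * ((r : ℂ) + κ ^ 2 * ((‖x‖ ^ 2 : ℝ) : ℂ))).re
      = κ.re * r + ‖κ‖ ^ 2 * κ.re * ‖x‖ ^ 2 := by
    have : starRingEnd ℂ κ * ((r : ℂ) + κ ^ 2 * ((‖x‖ ^ 2 : ℝ) : ℂ))
        = starRingEnd ℂ κ * r + ((‖κ‖ ^ 2 * ‖x‖ ^ 2 : ℝ) : ℂ) * κ := by
      have h3 : ((‖κ‖ ^ 2 : ℝ) : ℂ) = starRingEnd ℂ κ * κ := by
        rw [mul_comm, Complex.mul_conj, Complex.normSq_eq_norm_sq]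
      rw [Complex.ofReal_mul, h3]
      ring
    rw [this, Complex.add_re, Complex.re_mul_ofReal, Complex.re_ofReal_mul, Complex.conj_re]
    ring
  rw [h2] at h1
  have h3 : ‖κ‖ * (‖x‖ ^ 2 * (κ.re * ‖κ‖)) ≤ ‖κ‖ * ‖(r : ℂ) + κ ^ 2 * ((‖x‖ ^ 2 : ℝ) : ℂ)‖ := by
    nlinarith [mul_nonneg hκ.le hr]
  exact le_of_mul_le_mul_left h3 hκ0

/-- The operator `h₀` on `K`. -/
def vertexOp : (K → ℂ) →L[ℂ] (K → ℂ) :=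
  LinearMap.toContinuousLinearMap
    (LinearMap.funLeft ℂ ℂ (Sum.inl : K → Vtx K N) ∘ₗ freeOp E₀ a ∘ₗ
      LinearMap.pi (Sum.elim (fun x => LinearMap.proj x) fun _ => 0))

/-- The half-lines are not coupled to `K` in the free operator; they enter only through the diagonal
Dirichlet term. -/
lemma freeOp_inl (u : Vtx K N → ℂ) (x : K) :
    freeOp E₀ a u (Sum.inl x) = vertexOp E₀ a (fun y => u (Sum.inl y)) x := by
  simp [vertexOp, LinearMap.funLeft, freeOp]

/-- A null vector has vanishing quadratic form, so it is constant along edges and vanishes at every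
attachment vertex. Connectedness and the presence of a half-line make it zero; in finite dimension
injectivity suffices. -/
lemma isUnit_vertexOp (hconn : E₀.Connected) (hN : 0 < N) : IsUnit (vertexOp E₀ a) := by
  classical
  rw [ContinuousLinearMap.isUnit_iff_bijective]
  have hinj : Function.Injective (vertexOp E₀ a).toLinearMap := by
    rw [injective_iff_map_eq_zero]
    intro u hu
    set w : Vtx K N → ℂ := Sum.elim u fun _ => 0
    have h1 : ∀ x, freeOp E₀ a w (Sum.inl x) = 0 := fun x => by
      rw [freeOp_inl]
      exact congrFun hu x
    have h2 := sum_conj_mul_freeOp E₀ a w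
    simp only [h1, mul_zero, Finset.sum_const_zero, w, Sum.elim_inl] at h2
    have h3 : (∑ x, ∑ y, if E₀.Adj x y then ‖u x - u y‖ ^ 2 else 0)
        + 2 * ∑ α, ‖u (a α)‖ ^ 2 = 0 := by
      have h4 : (((∑ x, ∑ y, if E₀.Adj x y then ‖u x - u y‖ ^ 2 else 0)
        + 2 * ∑ α, ‖u (a α)‖ ^ 2 : ℝ) : ℂ) = 0 := by
        rw [h2]
        simp only [Complex.ofReal_add, Complex.ofReal_sum, Complex.ofReal_mul,
          Complex.ofReal_ofNat, apply_ite Complex.ofReal, Complex.ofReal_zero]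
      exact_mod_cast h4
    have hA : 0 ≤ ∑ x, ∑ y, if E₀.Adj x y then ‖u x - u y‖ ^ 2 else 0 :=
      Finset.sum_nonneg fun x _ => Finset.sum_nonneg fun y _ => by split_ifs <;> positivity
    have hB : 0 ≤ ∑ α, ‖u (a α)‖ ^ 2 := Finset.sum_nonneg fun α _ => by positivity
    have hA0 : ∑ x, ∑ y, (if E₀.Adj x y then ‖u x - u y‖ ^ 2 else 0) = 0 := by linarith
    have hB0 : ∑ α, ‖u (a α)‖ ^ 2 = 0 := by linarith
    have hadj : ∀ x y, E₀.Adj x y → u x = u y := by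
      intro x y hxy
      have h5 := (Finset.sum_eq_zero_iff_of_nonneg fun x _ => Finset.sum_nonneg fun y _ => by
        split_ifs <;> positivity).1 hA0 x (Finset.mem_univ x)
      have h6 := (Finset.sum_eq_zero_iff_of_nonneg fun y _ => by
        split_ifs <;> positivity).1 h5 y (Finset.mem_univ y)
      rw [if_pos hxy] at h6
      exact sub_eq_zero.1 (norm_eq_zero.1 (pow_eq_zero_iff two_ne_zero |>.1 h6))
    have h0 : u (a ⟨0, hN⟩) = 0 := by
      have h5 := (Finset.sum_eq_zero_iff_of_nonneg fun α _ => by positivity).1 hB0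
        ⟨0, hN⟩ (Finset.mem_univ _)
      exact norm_eq_zero.1 (pow_eq_zero_iff two_ne_zero |>.1 h5)
    funext x
    obtain ⟨p⟩ := hconn.preconnected x (a ⟨0, hN⟩)
    have : ∀ {y z : K}, E₀.Walk y z → u y = u z := fun p => by
      induction p with
      | nil => rfl
      | cons h _ ih => exact (hadj _ _ h).trans ih
    exact (this p).trans h0
  exact ⟨hinj, LinearMap.injective_iff_surjective.1 hinj⟩

end Positivity

/-! ### Green's function of the Dirichlet half-line -/

section RayKernel

/-- The half-line kernel `∑ c_p`, over the exponents `p = |n - m| + 1, |n - m| + 3, …, n + m + 1`;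
for `c_p = z^p` it is the resolvent kernel of the Dirichlet Laplacian. -/
def rayKernel (c : ℕ → ℂ) (n m : ℕ) : ℂ :=
  ∑ i ∈ Finset.range (min n m + 1), c (max n m - min n m + 1 + 2 * i)

/-- A geometric sum gives the closed form of the method of images, with the reflected term `z ^ (n +
m + 3)`: index `n` stands for the vertex `n + 1`. The sum itself is kept as the definition because
it remains meaningful at `z = 1`, that is at zero energy. -/
lemma one_sub_sq_mul_rayKernel (z : ℂ) (n m : ℕ) :
    (1 - z ^ 2) * rayKernel (fun p => z ^ p) n m
      = z ^ (max n m - min n m + 1) - z ^ (n + m + 3) := by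
  have h : n + m + 3 = max n m - min n m + 1 + 2 * (min n m + 1) := by omega
  rw [h, rayKernel]
  simp only [pow_add z _ (2 * _), pow_mul]
  rw [← Finset.mul_sum, mul_left_comm, mul_neg_geom_sum]
  ring

variable {z κ : ℂ}

/-- The equation at the first vertex, where the absent left neighbour is the Dirichlet condition. It
is checked after multiplication by `z (1 - z²)`, so that the closed form applies. -/
lemma rayKernel_zero (hz : z ≠ 0) (hz2 : 1 - z ^ 2 ≠ 0) (hκ : z + z⁻¹ = 2 + κ ^ 2) (m : ℕ) :
    (2 + κ ^ 2) * rayKernel (fun p => z ^ p) 0 m - rayKernel (fun p => z ^ p) 1 m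
      = if m = 0 then 1 else 0 := by
  have e : z * (2 + κ ^ 2) = z ^ 2 + 1 := by rw [← hκ]; field_simp
  apply mul_left_cancel₀ (mul_ne_zero hz hz2)
  have h0 := one_sub_sq_mul_rayKernel z 0 m
  have h1 := one_sub_sq_mul_rayKernel z 1 m
  have h2 : z * (1 - z ^ 2) * ((2 + κ ^ 2) * rayKernel (fun p => z ^ p) 0 m
      - rayKernel (fun p => z ^ p) 1 m)
      = (z ^ 2 + 1) * ((1 - z ^ 2) * rayKernel (fun p => z ^ p) 0 m)
        - z * ((1 - z ^ 2) * rayKernel (fun p => z ^ p) 1 m) := by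
    rw [← e]; ring
  rw [h2, h0, h1]
  rcases m with _ | m
  · norm_num; ring
  · have e0 : max 0 (m + 1) - min 0 (m + 1) + 1 = m + 2 := by omega
    have e1 : max 1 (m + 1) - min 1 (m + 1) + 1 = m + 1 := by omega
    rw [e0, e1]
    simp
    ring

/-- The same check in the interior, separately to the left of the source, at it, and to its right.
-/
lemma rayKernel_succ (hz : z ≠ 0) (hz2 : 1 - z ^ 2 ≠ 0) (hκ : z + z⁻¹ = 2 + κ ^ 2) (n m : ℕ) :
    (2 + κ ^ 2) * rayKernel (fun p => z ^ p) (n + 1) m - rayKernel (fun p => z ^ p) (n + 2) m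
      - rayKernel (fun p => z ^ p) n m = if n + 1 = m then 1 else 0 := by
  have e : z * (2 + κ ^ 2) = z ^ 2 + 1 := by rw [← hκ]; field_simp
  apply mul_left_cancel₀ (mul_ne_zero hz hz2)
  have h0 := one_sub_sq_mul_rayKernel z n m
  have h1 := one_sub_sq_mul_rayKernel z (n + 1) m
  have h2 := one_sub_sq_mul_rayKernel z (n + 2) m
  have h3 : z * (1 - z ^ 2) * ((2 + κ ^ 2) * rayKernel (fun p => z ^ p) (n + 1) m
      - rayKernel (fun p => z ^ p) (n + 2) m - rayKernel (fun p => z ^ p) n m)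
      = (z ^ 2 + 1) * ((1 - z ^ 2) * rayKernel (fun p => z ^ p) (n + 1) m)
        - z * ((1 - z ^ 2) * rayKernel (fun p => z ^ p) (n + 2) m)
        - z * ((1 - z ^ 2) * rayKernel (fun p => z ^ p) n m) := by
    rw [← e]; ring
  rw [h3, h0, h1, h2]
  rcases lt_trichotomy (n + 1) m with h | h | h
  · obtain ⟨k, rfl⟩ := Nat.exists_eq_add_of_le h
    have e0 : max n (n + 1 + 1 + k) - min n (n + 1 + 1 + k) + 1 = k + 3 := by omega
    have e1 : max (n + 1) (n + 1 + 1 + k) - min (n + 1) (n + 1 + 1 + k) + 1 = k + 2 := by omega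
    have e2 : max (n + 2) (n + 1 + 1 + k) - min (n + 2) (n + 1 + 1 + k) + 1 = k + 1 := by omega
    rw [e0, e1, e2, if_neg (by omega)]
    ring
  · subst h
    have e0 : max n (n + 1) - min n (n + 1) + 1 = 2 := by omega
    have e1 : max (n + 1) (n + 1) - min (n + 1) (n + 1) + 1 = 1 := by omega
    have e2 : max (n + 2) (n + 1) - min (n + 2) (n + 1) + 1 = 2 := by omega
    rw [e0, e1, e2, if_pos rfl]
    ring
  · obtain ⟨k, rfl⟩ := Nat.exists_eq_add_of_le (Nat.lt_succ_iff.1 h)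
    have e0 : max (m + k) m - min (m + k) m + 1 = k + 1 := by omega
    have e1 : max (m + k + 1) m - min (m + k + 1) m + 1 = k + 2 := by omega
    have e2 : max (m + k + 2) m - min (m + k + 2) m + 1 = k + 3 := by omega
    rw [e0, e1, e2, if_neg (by omega)]
    ring

lemma summable_norm_rayKernel (hz : ‖z‖ < 1) (m : ℕ) :
    Summable fun n => ‖rayKernel (fun p => z ^ p) n m‖ := by
  refine Summable.of_nonneg_of_le (fun _ => norm_nonneg _) (fun n => ?_)
    (((summable_nat_add_iff (f := fun n => ‖z‖ ^ n) 1).2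
      (summable_geometric_of_lt_one (norm_nonneg z) hz)).mul_left
      (((m : ℝ) + 1) * (‖z‖ ^ m)⁻¹))
  -- The bound divides by `‖z‖ ^ m`; for `z = 0` the kernel vanishes because all its exponents are
  -- at least `1`.
  rcases eq_or_ne z 0 with rfl | hz0
  · have : rayKernel (fun p => (0 : ℂ) ^ p) n m = 0 := 
      Finset.sum_eq_zero fun i _ => zero_pow (by omega)
    rw [this]; simp
  have h0 : 0 < ‖z‖ ^ m := pow_pos (norm_pos_iff.2 hz0) m
  have h1 : ∀ i, ‖z ^ (max n m - min n m + 1 + 2 * i)‖ ≤ (‖z‖ ^ m)⁻¹ * ‖z‖ ^ (n + 1) := fun i => by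
    rw [norm_pow, inv_mul_eq_div, le_div_iff₀ h0, ← pow_add]
    exact pow_le_pow_of_le_one (norm_nonneg _) hz.le (by omega)
  refine (norm_sum_le_of_le _ fun i _ => h1 i).trans ?_
  rw [Finset.sum_const, Finset.card_range, nsmul_eq_mul, mul_assoc]
  refine mul_le_mul_of_nonneg_right ?_ (by positivity)
  push_cast
  have : ((min n m : ℕ) : ℝ) ≤ m := by exact_mod_cast min_le_right n m
  push_cast at this
  linarith

/-- There are `min n m + 1` terms with exponents at most `2 (max n m + 1)`. The number of terms uses
one power of the smaller index and the size of the terms `j` powers of the larger one, so `J = max j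
1` is enough. -/
lemma norm_rayKernel_le {c : ℕ → ℂ} {C : ℝ} {j J : ℕ} (hC : 0 ≤ C)
    (hc : ∀ p, 1 ≤ p → ‖c p‖ ≤ C * (p : ℝ) ^ j) (hj : j ≤ J) (hJ : 1 ≤ J) (n m : ℕ) :
    ‖rayKernel c n m‖ ≤ C * 2 ^ j * (((n : ℝ) + 1) ^ J * ((m : ℝ) + 1) ^ J) := by
  have h1 : ∀ i ∈ Finset.range (min n m + 1), ‖c (max n m - min n m + 1 + 2 * i)‖
      ≤ C * 2 ^ j * ((max n m : ℕ) + 1 : ℝ) ^ J := fun i hi => by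
    refine (hc _ (by omega)).trans ?_
    rw [mul_assoc]
    refine mul_le_mul_of_nonneg_left ?_ hC
    have h2 : ((max n m - min n m + 1 + 2 * i : ℕ) : ℝ) ≤ 2 * ((max n m : ℕ) + 1 : ℝ) := by
      have := Finset.mem_range.1 hi
      have h3 : max n m - min n m + 1 + 2 * i ≤ 2 * (max n m + 1) := by omega
      exact_mod_cast h3
    calc ((max n m - min n m + 1 + 2 * i : ℕ) : ℝ) ^ j ≤ (2 * ((max n m : ℕ) + 1 : ℝ)) ^ j :=
          pow_le_pow_left₀ (Nat.cast_nonneg _) h2 j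
      _ = 2 ^ j * ((max n m : ℕ) + 1 : ℝ) ^ j := mul_pow _ _ _
      _ ≤ 2 ^ j * ((max n m : ℕ) + 1 : ℝ) ^ J := by
          gcongr
          have : (0 : ℝ) ≤ (max n m : ℕ) := Nat.cast_nonneg _
          linarith
  refine (norm_sum_le_of_le _ h1).trans ?_
  rw [Finset.sum_const, Finset.card_range, nsmul_eq_mul]
  have h4 : ((n : ℝ) + 1) ^ J * ((m : ℝ) + 1) ^ J
      = ((min n m : ℕ) + 1 : ℝ) ^ J * ((max n m : ℕ) + 1 : ℝ) ^ J := by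
    rcases le_total n m with h | h <;> simp [h, mul_comm]
  rw [h4]
  have h5 : ((min n m : ℕ) + 1 : ℝ) ≤ ((min n m : ℕ) + 1 : ℝ) ^ J :=
    le_self_pow₀ (by
      have : (0 : ℝ) ≤ (min n m : ℕ) := Nat.cast_nonneg _
      linarith) (by omega)
  calc ((min n m + 1 : ℕ) : ℝ) * (C * 2 ^ j * ((max n m : ℕ) + 1 : ℝ) ^ J)
      ≤ ((min n m : ℕ) + 1 : ℝ) ^ J * (C * 2 ^ j * ((max n m : ℕ) + 1 : ℝ) ^ J) := by
        push_cast at h5 ⊢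
        exact mul_le_mul_of_nonneg_right h5 (by positivity)
    _ = _ := by ring

end RayKernel

/-! ### The free resolvent as a block-diagonal kernel -/

section BlockKernel

variable {K : Type*} {N : ℕ}

open Classical in
/-- The kernel that is block diagonal with respect to `G = K ∪ L₁ ∪ … ∪ L_N`, with the matrix of
`A` on `K` and the kernel `rayKernel c` on every half-line. -/
def blockKernel (A : (K → ℂ) →L[ℂ] (K → ℂ)) (c : ℕ → ℂ) : Vtx K N → Vtx K N → ℂ
  | Sum.inl x, Sum.inl y => A (Pi.single y 1) x
  | Sum.inl _, Sum.inr _ => 0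
  | Sum.inr _, Sum.inl _ => 0
  | Sum.inr (α, n), Sum.inr (γ, m) => if α = γ then rayKernel c n m else 0

lemma blockKernel_sub (A B : (K → ℂ) →L[ℂ] (K → ℂ)) (c d : ℕ → ℂ) (x y : Vtx K N) :
    blockKernel (A - B) (fun p => c p - d p) x y = blockKernel A c x y - blockKernel B d x y := by
  rcases x with x | ⟨α, n⟩ <;> rcases y with y | ⟨γ, m⟩ <;> simp only [blockKernel, sub_zero]
  · rfl
  · split_ifs
    · simp [rayKernel]
    · simp

lemma blockKernel_sum (F : Finset ℕ) (q : ℕ → ℂ) (A : ℕ → (K → ℂ) →L[ℂ] (K → ℂ)) (c : ℕ → ℕ → ℂ)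
    (x y : Vtx K N) :
    blockKernel (∑ j ∈ F, q j • A j) (fun p => ∑ j ∈ F, q j * c j p) x y
      = ∑ j ∈ F, q j * blockKernel (A j) (c j) x y := by
  rcases x with x | ⟨α, n⟩ <;> rcases y with y | ⟨γ, m⟩ <;>
    simp only [blockKernel, mul_zero, Finset.sum_const_zero]
  · simp
  · split_ifs
    · simp only [rayKernel, Finset.mul_sum]
      exact Finset.sum_comm
    · simp

variable [Fintype K]

lemma norm_blockKernel_le {A : (K → ℂ) →L[ℂ] (K → ℂ)} {c : ℕ → ℂ} {C : ℝ} {j J : ℕ} (hA : ‖A‖ ≤ C)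
    (hc : ∀ p, 1 ≤ p → ‖c p‖ ≤ C * (p : ℝ) ^ j) (hj : j ≤ J) (hJ : 1 ≤ J) (x y : Vtx K N) :
    ‖blockKernel A c x y‖ ≤ C * 2 ^ j * (wt (J : ℝ) x * wt (J : ℝ) y) := by
  classical
  have hC : 0 ≤ C := (norm_nonneg A).trans hA
  have hw : 0 ≤ C * 2 ^ j * (wt (J : ℝ) x * wt (J : ℝ) y) :=
    mul_nonneg (by positivity) (mul_nonneg (wt_pos _ x).le (wt_pos _ y).le)
  rcases x with x | ⟨α, n⟩ <;> rcases y with y | ⟨γ, m⟩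
  · simp only [blockKernel, wt, mul_one]
    calc ‖A (Pi.single y 1) x‖ ≤ ‖A (Pi.single y 1)‖ := norm_le_pi_norm _ x
      _ ≤ ‖A‖ * ‖(Pi.single y 1 : K → ℂ)‖ := A.le_opNorm _
      _ ≤ C * 1 := by
          refine mul_le_mul hA ?_ (norm_nonneg _) hC
          rw [Pi.norm_single, norm_one]
      _ ≤ C * 2 ^ j := mul_le_mul_of_nonneg_left (one_le_pow₀ one_le_two) hC
  · simpa only [blockKernel, norm_zero] using hw
  · simpa only [blockKernel, norm_zero] using hw
  · simp only [blockKernel]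
    split_ifs
    · refine (norm_rayKernel_le hC hc hj hJ n m).trans ?_
      refine mul_le_mul_of_nonneg_left ?_ (by positivity)
      exact mul_le_mul (pow_le_wt J α n) (pow_le_wt J γ m) (by positivity) (wt_pos _ _).le
    · simpa only [norm_zero] using hw

variable (E₀ : SimpleGraph K) (a : Fin N → K)

lemma summable_norm_blockKernel {z : ℂ} (hz : ‖z‖ < 1) (A : (K → ℂ) →L[ℂ] (K → ℂ)) (y : Vtx K N) :
    Summable fun x => ‖blockKernel A (fun p => z ^ p) x y‖ := by
  refine summable_vtx fun α => ?_
  rcases y with y | ⟨γ, m⟩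
  · simpa only [blockKernel, norm_zero] using summable_zero
  · simp only [blockKernel]
    split_ifs
    · exact summable_norm_rayKernel hz m
    · simpa only [norm_zero] using summable_zero

lemma freeOp_blockKernel {z κ : ℂ} (hz : z ≠ 0) (hz2 : 1 - z ^ 2 ≠ 0) (hκ : z + z⁻¹ = 2 + κ ^ 2)
    (hK : IsUnit (vertexOp E₀ a + κ ^ 2 • 1)) [DecidableEq (Vtx K N)] (x y : Vtx K N) :
    freeOp E₀ a (fun x => blockKernel (Ring.inverse (vertexOp E₀ a + κ ^ 2 • 1))
        (fun p => z ^ p) x y) x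
      + κ ^ 2 * blockKernel (Ring.inverse (vertexOp E₀ a + κ ^ 2 • 1)) (fun p => z ^ p) x y
      = if x = y then 1 else 0 := by
  classical
  set B := Ring.inverse (vertexOp E₀ a + κ ^ 2 • 1) with hB
  rcases x with x | ⟨α, n⟩
  · rw [freeOp_inl]
    rcases y with y | ⟨γ, m⟩
    · have h1 : (vertexOp E₀ a + κ ^ 2 • 1) * B = 1 := Ring.mul_inverse_cancel _ hK
      have h2 := congrFun (congrArg (fun T : (K → ℂ) →L[ℂ] (K → ℂ) => T (Pi.single y 1)) h1) x
      simp only [mul_apply_eq_comp, one_apply_eq_self, add_apply, smul_apply, Pi.add_apply,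
        Pi.smul_apply, smul_eq_mul] at h2
      simp only [blockKernel, Sum.inl.injEq]
      rw [← Pi.single_apply]
      exact h2
    · have : (fun x : K => blockKernel B (fun p => z ^ p) (Sum.inl x) (Sum.inr (γ, m))) = 0 := rfl
      rw [this, map_zero]
      simp [blockKernel]
  · rcases y with y | ⟨γ, m⟩
    · rcases n with _ | n <;> simp [freeOp, blockKernel]
    · by_cases hαγ : α = γ
      · subst hαγ
        rcases n with _ | n
        · have h := rayKernel_zero hz hz2 hκ m
          simp only [freeOp, blockKernel, LinearMap.coe_mk, AddHom.coe_mk, if_true,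
            Sum.inr.injEq, Prod.mk.injEq, true_and]
          simp only [eq_comm (a := 0) (b := m)]
          rw [← h]; ring
        · have h := rayKernel_succ hz hz2 hκ n m
          simp only [freeOp, blockKernel, LinearMap.coe_mk, AddHom.coe_mk, if_true,
            Sum.inr.injEq, Prod.mk.injEq, true_and]
          rw [← h]; ring
      · rcases n with _ | n <;> simp [freeOp, blockKernel, hαγ]

lemma hasKernel_free_resolvent {s : ℝ} (hs : 0 ≤ s) {z κ : ℂ} (hz : z ≠ 0) (hz1 : ‖z‖ < 1)
    (hκ : z + z⁻¹ = 2 + κ ^ 2)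
    (hK : IsUnit (vertexOp E₀ a + κ ^ 2 • 1)) (hH : IsUnit (freeHil E₀ a + κ ^ 2 • 1)) :
    HasKernel (toBop hs (Ring.inverse (freeHil E₀ a + κ ^ 2 • 1)))
      (blockKernel (Ring.inverse (vertexOp E₀ a + κ ^ 2 • 1)) fun p => z ^ p) := by
  classical
  intro u x
  set B := Ring.inverse (vertexOp E₀ a + κ ^ 2 • 1) with hB
  have hz2 : 1 - z ^ 2 ≠ 0 := by
    intro h
    have h1 : ‖z‖ ^ 2 = 1 := by rw [← norm_pow, ← sub_eq_zero.1 h, norm_one]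
    nlinarith [norm_nonneg z]
  have hmem : ∀ y : Vtx K N, Memℓp (fun x => blockKernel B (fun p => z ^ p) x y) 2 := fun y => by
    have h1 : Memℓp (fun x => blockKernel B (fun p => z ^ p) x y) 1 := by
      refine memℓp_gen ?_
      simpa using summable_norm_blockKernel hz1 B y
    exact h1.of_exponent_ge (by norm_num)
  -- Each column is square summable since `‖z‖ < 1`, and it solves the resolvent equation with a
  -- unit source; invertibility identifies it with the resolvent applied to that source.
  have hcol : ∀ y : Vtx K N, Ring.inverse (freeHil E₀ a + κ ^ 2 • 1)
      (lp.single 2 y (1 : ℂ)) = ⟨_, hmem y⟩ := by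
    intro y
    have h1 : (freeHil E₀ a + κ ^ 2 • 1) (⟨_, hmem y⟩ : Hil K N) = lp.single 2 y (1 : ℂ) := by
      refine Subtype.ext (funext fun x => ?_)
      rw [lp.single_apply]
      refine (freeOp_blockKernel E₀ a hz hz2 hκ hK x y).trans ?_
      rw [Pi.single_apply]
    rw [← h1, ← mul_apply_eq_comp, Ring.inverse_mul_cancel _ hH, one_apply_eq_self]
  have h2 := (lp.hasSum_single (p := 2) (by norm_num) (Lone.toHil hs u)).mapL
    ((lp.evalCLM ℂ (fun _ : Vtx K N => ℂ) 2 x).comp (Ring.inverse (freeHil E₀ a + κ ^ 2 • 1)))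
  have e : (fun y => blockKernel B (fun p => z ^ p) x y * u y) = fun y =>
      ((lp.evalCLM ℂ (fun _ : Vtx K N => ℂ) 2 x).comp (Ring.inverse (freeHil E₀ a + κ ^ 2 • 1)))
        (lp.single 2 y (Lone.toHil hs u y)) := by
    funext y
    have h3 : lp.single 2 y (Lone.toHil hs u y)
        = u y • (lp.single 2 y (1 : ℂ) : Hil K N) := by
      rw [← lp.single_smul, smul_eq_mul, mul_one]
      rfl
    rw [h3, map_smul, ContinuousLinearMap.comp_apply, hcol, smul_eq_mul, mul_comm]
    rfl
  rw [e]
  exact h2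

end BlockKernel

/-! ### The dispersion relation and uniform expansion of powers -/

section Dispersion

/-- The solution `z = exp (-θ)`, `κ = 2 sinh (θ / 2)`, of `z + z⁻¹ = 2 + κ²` near `κ = 0`. -/
def dispersion (κ : ℂ) : ℂ := ((1 + κ ^ 2 / 4) ^ ((2 : ℕ) : ℂ)⁻¹ - κ / 2) ^ 2

lemma analyticAt_dispersion : AnalyticAt ℂ dispersion 0 := by
  have h1 : AnalyticAt ℂ (fun κ : ℂ => 1 + κ ^ 2 / 4) 0 := by fun_prop
  have h2 : AnalyticAt ℂ (fun κ : ℂ => (1 + κ ^ 2 / 4) ^ ((2 : ℕ) : ℂ)⁻¹) 0 :=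
    h1.cpow analyticAt_const (by simp)
  unfold dispersion
  fun_prop

lemma dispersion_zero : dispersion 0 = 1 := by simp [dispersion]

/-- With `w² = 1 + κ²/4` one has `(w - κ/2) (w + κ/2) = 1`, so the inverse of `(w - κ/2)²` is `(w +
κ/2)²` and the sum is `2 w² + κ²/2`. -/
lemma dispersion_ne_zero_and_add_inv (κ : ℂ) :
    dispersion κ ≠ 0 ∧ dispersion κ + (dispersion κ)⁻¹ = 2 + κ ^ 2 := by
  have hw : ((1 + κ ^ 2 / 4) ^ ((2 : ℕ) : ℂ)⁻¹) ^ 2 = 1 + κ ^ 2 / 4 :=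
    Complex.cpow_nat_inv_pow _ two_ne_zero
  unfold dispersion
  set w := (1 + κ ^ 2 / 4) ^ ((2 : ℕ) : ℂ)⁻¹
  have h1 : (w - κ / 2) ^ 2 * (w + κ / 2) ^ 2 = 1 := by
    have : (w - κ / 2) * (w + κ / 2) = 1 := by linear_combination hw
    rw [← mul_pow, this, one_pow]
  refine ⟨left_ne_zero_of_mul_eq_one h1, ?_⟩
  rw [inv_eq_of_mul_eq_one_right h1]
  linear_combination 2 * hw

/-- As `|w - κ/2|` and `|w + κ/2|` have product `1`, it suffices that the first is smaller, that is
`Re (w conj κ) > 0`. The real parts of `w` and `κ` are positive, and the imaginary part of `w² = 1 +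
κ²/4` shows that their imaginary parts have nonnegative product. -/
lemma eventually_norm_dispersion_lt_one : ∀ᶠ κ in rightZero, ‖dispersion κ‖ < 1 := by
  have h1 : AnalyticAt ℂ (fun κ : ℂ => (1 + κ ^ 2 / 4) ^ ((2 : ℕ) : ℂ)⁻¹) 0 :=
    AnalyticAt.cpow (by fun_prop) analyticAt_const (by simp)
  have h2 : ∀ᶠ κ in 𝓝 (0 : ℂ), 0 < ((1 + κ ^ 2 / 4) ^ ((2 : ℕ) : ℂ)⁻¹).re :=
    (Complex.continuous_re.continuousAt.comp h1.continuousAt).eventually (lt_mem_nhds (by simp))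
  filter_upwards [eventually_re_pos, h2.filter_mono nhdsWithin_le_nhds] with κ hκ hre
  have hw : ((1 + κ ^ 2 / 4) ^ ((2 : ℕ) : ℂ)⁻¹) ^ 2 = 1 + κ ^ 2 / 4 :=
    Complex.cpow_nat_inv_pow _ two_ne_zero
  unfold dispersion
  set w := (1 + κ ^ 2 / 4) ^ ((2 : ℕ) : ℂ)⁻¹
  have him : 4 * (w.re * w.im) = κ.re * κ.im := by
    have h3 := congrArg Complex.im hw
    simp [pow_two] at h3
    linarith
  have h4 : 0 ≤ w.im * κ.im := by
    have h5 : 0 ≤ w.re * (w.im * κ.im) := by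
      have h6 : w.re * (w.im * κ.im) = κ.re * κ.im ^ 2 / 4 := by linear_combination κ.im / 4 * him
      rw [h6]
      positivity
    exact nonneg_of_mul_nonneg_right h5 hre
  have h7 : ‖w - κ / 2‖ ^ 2 < ‖w + κ / 2‖ ^ 2 := by
    rw [← Complex.normSq_eq_norm_sq, ← Complex.normSq_eq_norm_sq, Complex.normSq_apply,
      Complex.normSq_apply]
    simp only [Complex.sub_re, Complex.sub_im, Complex.add_re, Complex.add_im,
      Complex.div_ofNat_re, Complex.div_ofNat_im]
    nlinarith [mul_pos hre hκ]
  have h8 : ‖w - κ / 2‖ ^ 2 * ‖w + κ / 2‖ ^ 2 = 1 := by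
    have : (w - κ / 2) * (w + κ / 2) = 1 := by linear_combination hw
    rw [← mul_pow, ← norm_mul, this, norm_one, one_pow]
  rw [norm_pow]
  nlinarith [sq_nonneg ‖w - κ / 2‖]

/-- Taylor's formula at `1` with a remainder explicit in `p`, by Pascal's rule. The condition `‖z‖ ≤
1` keeps the constant polynomial in `p` rather than exponential. -/
lemma norm_pow_sub_binomial_le {z : ℂ} (hz : ‖z‖ ≤ 1) (n p : ℕ) :
    ‖z ^ p - ∑ l ∈ Finset.range n, (p.choose l : ℂ) * (z - 1) ^ l‖
      ≤ p.choose n * ‖z - 1‖ ^ n := by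
  induction n generalizing p with
  | zero => simpa using pow_le_one₀ (norm_nonneg z) hz
  | succ n ih =>
    induction p with
    | zero => simp [Finset.sum_range_succ']
    | succ p ihp =>
      have e : z ^ (p + 1) - ∑ l ∈ Finset.range (n + 1), ((p + 1).choose l : ℂ) * (z - 1) ^ l
          = (z ^ p - ∑ l ∈ Finset.range (n + 1), (p.choose l : ℂ) * (z - 1) ^ l)
            + (z - 1) * (z ^ p - ∑ l ∈ Finset.range n, (p.choose l : ℂ) * (z - 1) ^ l) := by
        rw [Finset.sum_range_succ' _ n, Finset.sum_range_succ' _ n, mul_sub, Finset.mul_sum]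
        simp only [Nat.choose_succ_succ, Nat.cast_add, add_mul, Finset.sum_add_distrib,
          Nat.choose_zero_right]
        have : ∑ l ∈ Finset.range n, (p.choose l : ℂ) * (z - 1) ^ (l + 1)
            = ∑ l ∈ Finset.range n, (z - 1) * ((p.choose l : ℂ) * (z - 1) ^ l) :=
          Finset.sum_congr rfl fun l _ => by ring
        rw [this]
        ring
      rw [e]
      refine (norm_add_le _ _).trans ?_
      rw [norm_mul, Nat.choose_succ_succ]
      push_cast
      have := mul_le_mul_of_nonneg_left (ih p) (norm_nonneg (z - 1))
      calc _ ≤ (p.choose (n + 1) : ℝ) * ‖z - 1‖ ^ (n + 1) + ‖z - 1‖ * (p.choose n * ‖z - 1‖ ^ n) :=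
            add_le_add ihp this
        _ = _ := by ring

/-- The point is that the `l`-th power of a function vanishing at `0` has no coefficients below
order `l`; this limits the growth in `p` of the coefficients of `ζ ^ p`. -/
lemma exists_hasExpansion_pow {w : ℂ → ℂ} {b : ℕ → ℂ} {n : ℕ} (hw : HasExpansion w b n)
    (hb : b 0 = 0) (l : ℕ) :
    ∃ d : ℕ → ℂ, HasExpansion (fun κ => w κ ^ l) d n ∧ (∀ j < l, d j = 0) ∧
      (l = 0 → d 0 = 1) := by
  induction l with
  | zero => exact ⟨_, by simpa using HasExpansion.const (1 : ℂ) n, by simp, by simp⟩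
  | succ l ih =>
    obtain ⟨d, hd, hd0, -⟩ := ih
    refine ⟨_, (hd.bilin hw (ContinuousLinearMap.mul ℂ ℂ)).congr
      (Eventually.of_forall fun κ => by simp [pow_succ]), fun j hj => ?_, by simp⟩
    refine Finset.sum_eq_zero fun p hp => ?_
    have := Finset.HasAntidiagonal.mem_antidiagonal.1 hp
    rcases lt_or_ge p.1 l with h | h
    · simp [hd0 _ h]
    · have : p.2 = 0 := by omega
      simp [this, hb]

/-- Expansion of the powers of `ζ`, with control of the coefficients and of the remainder in the
exponent. -/
lemma exists_expansion_powers {ζ : ℂ → ℂ} (hζ : AnalyticAt ℂ ζ 0) (h0 : ζ 0 = 1)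
    (h1 : ∀ᶠ κ in rightZero, ‖ζ κ‖ ≤ 1) {n : ℕ} (hn : 0 < n) :
    ∃ c : ℕ → ℕ → ℂ, (∀ p, c 0 p = 1) ∧
      (∀ j < n, ∃ C : ℝ, ∀ p, 1 ≤ p → ‖c j p‖ ≤ C * (p : ℝ) ^ j) ∧
      ∃ C : ℝ, ∀ᶠ κ in rightZero, ∀ p, 1 ≤ p →
        ‖ζ κ ^ p - ∑ j ∈ Finset.range n, κ ^ j * c j p‖ ≤ C * ‖κ‖ ^ n * (p : ℝ) ^ n := by
  obtain ⟨b, hb, hb0⟩ := HasExpansion.of_analyticAt (f := fun κ => ζ κ - 1)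
    (hζ.sub analyticAt_const) n
  rw [h0, sub_self] at hb0
  choose d hd hd0 hd1 using fun l => exists_hasExpansion_pow hb hb0 l
  have hch : ∀ p l : ℕ, (p.choose l : ℝ) ≤ (p : ℝ) ^ l := fun p l => by
    exact_mod_cast Nat.choose_le_pow p l
  -- The coefficients come from inserting the expansions of `(ζ - 1) ^ l` into the binomial series.
  -- Only `l ≤ j` contributes to order `j`, so they grow at most like `p ^ j`.
  refine ⟨fun j p => ∑ l ∈ Finset.range n, (p.choose l : ℂ) * d l j, fun p => ?_, fun j hj => ?_, ?_⟩
  · beta_reduce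
    rw [Finset.sum_eq_single 0]
    · simp [hd1 0 rfl]
    · intro l _ hl
      rw [hd0 l 0 (Nat.pos_of_ne_zero hl), mul_zero]
    · intro h
      exact absurd (Finset.mem_range.2 hn) h
  · refine ⟨∑ l ∈ Finset.range n, ‖d l j‖, fun p hp => ?_⟩
    rw [Finset.sum_mul]
    refine norm_sum_le_of_le _ fun l _ => ?_
    rcases lt_or_ge j l with h | h
    · rw [hd0 l j h, mul_zero, norm_zero]
      simp
    · rw [norm_mul, mul_comm, Complex.norm_natCast]
      refine mul_le_mul_of_nonneg_left ((hch p l).trans ?_) (norm_nonneg _)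
      exact pow_le_pow_right₀ (by exact_mod_cast hp) h
  · have hwn : (fun κ => (ζ κ - 1) ^ n) =O[rightZero] fun κ : ℂ => κ ^ n := by
      have h2 := hd n
      refine IsBigO.congr_left h2 fun κ => ?_
      rw [Finset.sum_eq_zero, sub_zero]
      intro j hj
      rw [hd0 n j (Finset.mem_range.1 hj), smul_zero]
    obtain ⟨D, hD⟩ := hwn.bound
    choose Dl hDl using fun l => (hd l).bound
    have hall : ∀ᶠ κ in rightZero, ∀ l ∈ Finset.range n,
        ‖(ζ κ - 1) ^ l - ∑ j ∈ Finset.range n, κ ^ j • d l j‖ ≤ Dl l * ‖κ ^ n‖ :=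
      (Finset.eventually_all _).2 fun l _ => hDl l
    refine ⟨D + ∑ l ∈ Finset.range n, Dl l, ?_⟩
    filter_upwards [h1, hD, hall] with κ hκ1 hκD hκl p hp
    have hp1 : (1 : ℝ) ≤ p := by exact_mod_cast hp
    -- The error splits into the tail of the binomial series and the errors in the expansions of the
    -- powers `(ζ - 1) ^ l`.
    have e : ζ κ ^ p - ∑ j ∈ Finset.range n, κ ^ j * ∑ l ∈ Finset.range n, (p.choose l : ℂ) * d l j
        = (ζ κ ^ p - ∑ l ∈ Finset.range n, (p.choose l : ℂ) * (ζ κ - 1) ^ l)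
          + ∑ l ∈ Finset.range n, (p.choose l : ℂ) *
            ((ζ κ - 1) ^ l - ∑ j ∈ Finset.range n, κ ^ j • d l j) := by
      simp only [mul_sub, Finset.sum_sub_distrib, Finset.mul_sum, smul_eq_mul]
      rw [Finset.sum_comm (s := Finset.range n) (t := Finset.range n)
        (f := fun x i => κ ^ x * ((p.choose i : ℂ) * d i x))]
      have : ∑ y ∈ Finset.range n, ∑ x ∈ Finset.range n, κ ^ x * ((p.choose y : ℂ) * d y x)
          = ∑ y ∈ Finset.range n, ∑ x ∈ Finset.range n, (p.choose y : ℂ) * (κ ^ x * d y x) :=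
        Finset.sum_congr rfl fun _ _ => Finset.sum_congr rfl fun _ _ => by ring
      rw [this]
      ring
    rw [e]
    refine (norm_add_le _ _).trans ?_
    have h3 : ‖ζ κ ^ p - ∑ l ∈ Finset.range n, (p.choose l : ℂ) * (ζ κ - 1) ^ l‖
        ≤ (p : ℝ) ^ n * (D * ‖κ‖ ^ n) := by
      refine (norm_pow_sub_binomial_le hκ1 n p).trans ?_
      rw [norm_pow, norm_pow] at hκD
      exact mul_le_mul (hch p n) hκD (by positivity) (by positivity)
    have h4 : ‖∑ l ∈ Finset.range n, (p.choose l : ℂ) *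
        ((ζ κ - 1) ^ l - ∑ j ∈ Finset.range n, κ ^ j • d l j)‖
        ≤ ∑ l ∈ Finset.range n, (p : ℝ) ^ n * (Dl l * ‖κ‖ ^ n) := by
      refine norm_sum_le_of_le _ fun l hl => ?_
      have h5 := hκl l hl
      rw [norm_pow] at h5
      rw [norm_mul, Complex.norm_natCast]
      refine mul_le_mul ((hch p l).trans ?_) h5 (norm_nonneg _) (by positivity)
      exact pow_le_pow_right₀ hp1 (Finset.mem_range.1 hl).le
    refine (add_le_add h3 h4).trans (le_of_eq ?_)
    rw [← Finset.mul_sum, ← Finset.sum_mul]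
    ring

end Dispersion

/-! ### Expansion of the free resolvent -/

section FreeExpansion

variable {K : Type*} {N : ℕ} [Fintype K] (E₀ : SimpleGraph K) (a : Fin N → K)

lemma eventually_hasKernel_free_resolvent (hconn : E₀.Connected) (hN : 0 < N) {s : ℝ}
    (hs : 0 ≤ s) :
    ∀ᶠ κ in rightZero, HasKernel (toBop hs (Ring.inverse (freeHil E₀ a + κ ^ 2 • 1)))
      (blockKernel (Ring.inverse (vertexOp E₀ a + κ ^ 2 • 1)) fun p => dispersion κ ^ p) := by
  have hc : Tendsto (fun κ : ℂ => vertexOp E₀ a + κ ^ 2 • 1) rightZero (𝓝 (vertexOp E₀ a)) := by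
    have h1 := ((HasExpansion.const (vertexOp E₀ a) 1).add
      (HasExpansion.pow_smul_const (1 : (K → ℂ) →L[ℂ] (K → ℂ)) 2 1)).tendsto one_pos
    simpa using h1
  filter_upwards [eventually_re_pos, eventually_norm_dispersion_lt_one,
    hc.eventually (Units.isOpen.mem_nhds (isUnit_vertexOp E₀ a hconn hN))] with κ hκ hz hK
  exact hasKernel_free_resolvent E₀ a hs (dispersion_ne_zero_and_add_inv κ).1 hz
    (dispersion_ne_zero_and_add_inv κ).2 hK (isUnit_freeHil_add E₀ a hκ)

/-- The two blocks of the kernel are expanded separately: on `K` by inverting a matrix-valued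
expansion, on the half-lines by expanding powers uniformly. Kernel bounds then yield both the
remainder estimate and the better weights of the coefficients. -/
theorem exists_free_expansion (hconn : E₀.Connected) (hN : 0 < N) {n : ℕ} (hn : 0 < n) {s : ℝ}
    (hs : 0 ≤ s) (hns : n ≤ s) :
    ∃ g : ℕ → Bop K N s,
      HasExpansion (fun κ => toBop hs (Ring.inverse (freeHil E₀ a + κ ^ 2 • 1))) g n ∧
      (∀ j < n, (g j).MemB ((max j 1 : ℕ) : ℝ)) ∧
      HasKernel (g 0) (blockKernel (Ring.inverse (vertexOp E₀ a)) fun _ => 1) := by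
  obtain ⟨m, rfl⟩ : ∃ m, n = m + 1 := ⟨n - 1, by omega⟩
  obtain ⟨c, hc0, hcj, D, hD⟩ := exists_expansion_powers analyticAt_dispersion dispersion_zero
    (eventually_norm_dispersion_lt_one.mono fun _ h => h.le) hn
  have hV := (HasExpansion.const (vertexOp E₀ a) (m + 1)).add
    (HasExpansion.pow_smul_const (1 : (K → ℂ) →L[ℂ] (K → ℂ)) 2 (m + 1))
  have hVu := isUnit_vertexOp E₀ a hconn hN
  obtain ⟨b, hb⟩ := hV.ring_inverse m (by simpa using hVu)
  have hb0 : b 0 = Ring.inverse (vertexOp E₀ a) := by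
    refine tendsto_nhds_unique (hb.tendsto m.succ_pos) ?_
    obtain ⟨x, hx⟩ := hVu
    have h1 := hV.tendsto m.succ_pos
    simp only [if_true, if_neg (show ¬ (0 = 2) by norm_num), add_zero] at h1
    rw [← hx] at h1 ⊢
    exact (NormedRing.inverse_continuousAt x).tendsto.comp h1
  have hex : ∀ j, ∃ T : Bop K N s, j < m + 1 →
      HasKernel T (blockKernel (b j) (c j)) ∧ T.MemB ((max j 1 : ℕ) : ℝ) := by
    intro j
    by_cases hj : j < m + 1
    · obtain ⟨C, hC⟩ := hcj j hj
      -- The weight is `max j 1` rather than `j`: even at `j = 0` the number of terms of the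
      -- half-line kernel grows like the smaller index.
      have hk := norm_blockKernel_le (N := N) (A := b j) (c := c j) (C := max ‖b j‖ C) (j := j)
        (J := max j 1)
        (le_max_left _ _) (fun p hp => (hC p hp).trans (by gcongr; exact le_max_right _ _))
        (le_max_left _ _) (le_max_right _ _)
      have hC0 : 0 ≤ max ‖b j‖ C * 2 ^ j :=
        mul_nonneg ((norm_nonneg _).trans (le_max_left _ _)) (by positivity)
      have hle : ((max j 1 : ℕ) : ℝ) ≤ s := by
        refine le_trans ?_ hns
        exact_mod_cast (by omega : max j 1 ≤ m + 1)
      obtain ⟨T, hT⟩ := HasKernel.exists_of_bound (s := s) (blockKernel (b j) (c j)) hC0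
        fun x y => (hk x y).trans (mul_le_mul_of_nonneg_left
          (mul_le_mul (wt_mono hle x) (wt_mono hle y) (wt_pos _ _).le (wt_pos _ _).le) hC0)
      exact ⟨T, fun _ => ⟨hT, hT.memB hC0 hk⟩⟩
    · exact ⟨0, fun h => absurd h hj⟩
  choose g hg using hex
  refine ⟨g, ?_, fun j hj => (hg j hj).2, ?_⟩
  · obtain ⟨B, hB⟩ := IsBigO.bound hb
    refine IsBigO.of_bound (max B D * 2 ^ (m + 1)) ?_
    filter_upwards [hB, hD, eventually_hasKernel_free_resolvent E₀ a hconn hN hs] with κ hκB hκD hκ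
    have hker := hκ.sub (HasKernel.sum_smul (Finset.range (m + 1)) (fun j => κ ^ j)
      fun j hj => (hg j (Finset.mem_range.1 hj)).1)
    simp only [← blockKernel_sum, ← blockKernel_sub] at hker
    rw [norm_pow] at hκB ⊢
    have hBD : 0 ≤ max B D * ‖κ‖ ^ (m + 1) :=
      (norm_nonneg _).trans (hκB.trans (by gcongr; exact le_max_left _ _))
    have hk := norm_blockKernel_le (N := N) (C := max B D * ‖κ‖ ^ (m + 1)) (J := m + 1)
      (hκB.trans (by gcongr; exact le_max_left _ _))
      (fun p hp => (hκD p hp).trans (by gcongr; exact le_max_right _ _)) le_rfl (by omega)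
    have h2 := hker.norm_le (C := max B D * ‖κ‖ ^ (m + 1) * 2 ^ (m + 1))
      (mul_nonneg hBD (by positivity)) fun x y => (hk x y).trans (mul_le_mul_of_nonneg_left
          (mul_le_mul (wt_mono hns x) (wt_mono hns y) (wt_pos _ _).le (wt_pos _ _).le)
          (mul_nonneg hBD (by positivity)))
    calc _ ≤ _ := h2
      _ = _ := by ring
  · have h := (hg 0 m.succ_pos).1
    rw [hb0] at h
    rwa [show c 0 = fun _ => 1 from funext hc0] at h

end FreeExpansion

/-! ### Compactness of the embedding into the space of weight one -/

section Compactness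

variable {K : Type*} {N : ℕ} [Fintype K]

/-- Composition with the embedding `𝓛^t ⊆ 𝓛^1` gives a compact operator if `t ≥ 2`. -/
lemma isCompactOperator_comp_incl {t : ℝ} (ht : 2 ≤ t) (h1t : 1 ≤ t) {E : Type*}
    [NormedAddCommGroup E] [NormedSpace ℂ E] [CompleteSpace E] (W : Lone K N 1 →L[ℂ] E) :
    IsCompactOperator (W.comp (Lone.incl h1t)) := by
  classical
  -- Truncation to `K` and the first `R` vertices of each half-line. Off this set the weight of
  -- order `t - 1 ≥ 1` is at least `R + 1`, so the error is at most `1 / (R + 1)` in operator norm.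
  let S : ℕ → Finset (Vtx K N) := fun R => Finset.univ.disjSum (Finset.univ ×ˢ Finset.range R)
  let r : ∀ R, Lone K N t →L[ℂ] (S R → ℂ) := fun R =>
    LinearMap.mkContinuous
      { toFun := fun u x => u x
        map_add' := fun _ _ => rfl
        map_smul' := fun _ _ => rfl } 1 fun u => by
      rw [one_mul]
      exact (pi_norm_le_iff_of_nonneg (norm_nonneg u)).2 fun x =>
        u.norm_apply_le (by linarith) x
  let e : ∀ R, (S R → ℂ) →L[ℂ] Lone K N 1 := fun R => LinearMap.toContinuousLinearMap
    { toFun := fun w => ⟨fun x => if h : x ∈ S R then w ⟨x, h⟩ else 0,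
        summable_of_hasFiniteSupport ((S R).finite_toSet.subset fun x hx => by
          by_contra h
          exact hx (by simp [show x ∉ S R from h]))⟩
      map_add' := fun w w' => Lone.ext_apply fun x => by
        change (if h : x ∈ S R then (w + w') ⟨x, h⟩ else 0)
          = (if h : x ∈ S R then w ⟨x, h⟩ else 0) + (if h : x ∈ S R then w' ⟨x, h⟩ else 0)
        split_ifs <;> simp
      map_smul' := fun c w => Lone.ext_apply fun x => by
        change (if h : x ∈ S R then (c • w) ⟨x, h⟩ else 0)
          = c * (if h : x ∈ S R then w ⟨x, h⟩ else 0)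
        split_ifs <;> simp }
  have hbound : ∀ R, ‖(e R).comp (r R) - Lone.incl h1t‖ ≤ 1 / ((R : ℝ) + 1) := by
    intro R
    refine ContinuousLinearMap.opNorm_le_bound _ (by positivity) fun u => ?_
    rw [Lone.norm_def, Lone.norm_def, ← tsum_mul_left]
    refine Summable.tsum_le_tsum (fun x => ?_) (Lone.summable _) (u.summable.mul_left _)
    have hx : ((e R).comp (r R) - Lone.incl h1t : Lone K N t →L[ℂ] Lone K N 1) u x
        = (if x ∈ S R then u x else 0) - u x := by
      change (if h : x ∈ S R then r R u ⟨x, h⟩ else 0) - u x = _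
      split_ifs <;> rfl
    rw [hx]
    have hnn : 0 ≤ wt t x * ‖u x‖ := mul_nonneg (wt_pos t x).le (norm_nonneg _)
    split_ifs with h
    · rw [sub_self, norm_zero, mul_zero]
      positivity
    · rcases x with x | ⟨α, n⟩
      · exact absurd (by simp [S]) h
      have hn : R ≤ n := by
        by_contra hlt
        exact h (by simpa [S] using hlt)
      have h2 : (R : ℝ) + 1 ≤ wt (t - 1) (Sum.inr (α, n) : Vtx K N) := by
        have h3 := pow_le_wt (K := K) 1 α n
        have h4 := wt_mono (by push_cast; linarith : ((1 : ℕ) : ℝ) ≤ t - 1)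
          (Sum.inr (α, n) : Vtx K N)
        have h5 : (R : ℝ) ≤ n := by exact_mod_cast hn
        rw [pow_one] at h3
        linarith
      have h3 := wt_add (t - 1) 1 (Sum.inr (α, n) : Vtx K N)
      rw [sub_add_cancel] at h3
      rw [zero_sub, norm_neg, h3, one_div, inv_mul_eq_div, le_div_iff₀ (by positivity)]
      have h4 : 0 ≤ wt 1 (Sum.inr (α, n) : Vtx K N) * ‖u (Sum.inr (α, n))‖ :=
        mul_nonneg (wt_pos _ _).le (norm_nonneg _)
      nlinarith
  have hlim : Tendsto (fun R => W.comp ((e R).comp (r R))) atTop (𝓝 (W.comp (Lone.incl h1t))) := by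
    rw [tendsto_iff_norm_sub_tendsto_zero]
    refine squeeze_zero (fun _ => norm_nonneg _) (fun R => ?_)
      (by simpa only [mul_zero] using (tendsto_one_div_add_atTop_nhds_zero_nat (𝕜 := ℝ)).const_mul ‖W‖)
    rw [← ContinuousLinearMap.comp_sub]
    exact (ContinuousLinearMap.opNorm_comp_le _ _).trans
      (mul_le_mul_of_nonneg_left (hbound R) (norm_nonneg _))
  exact isCompactOperator_of_tendsto hlim (Eventually.of_forall fun R =>
    (isCompactOperator_of_locallyCompactSpace_dom (r R)).clm_comp (W.comp (e R)))

end Compactness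

/-! ### The zero-energy Green operator -/

section ZeroEnergy

variable {K : Type*} {N : ℕ}

/-- Exchange of summation. For fixed `m` only the indices `n < m` contribute, and each contributes
at most the weight at `m` times `m + 1`. The sum over `n` thus costs `m (m + 1)`, exactly the two
orders of weight that are given up. -/
lemma summable_ray_tail {s : ℝ} (hs : 2 ≤ s) (f : Lone K N s) (α : Fin N) (T : ℕ → ℂ)
    (k : ℕ → Vtx K N → ℂ) (hT : ∀ n, HasSum (fun y => k n y * f y) (T n))
    (hinl : ∀ n x, k n (Sum.inl x) = 0)
    (hlt : ∀ n γ m, m ≤ n → k n (Sum.inr (γ, m)) = 0)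
    (hle : ∀ n γ m, ‖k n (Sum.inr (γ, m))‖ ≤ (m : ℝ) + 1) :
    Summable fun n => wt (s - 2) (Sum.inr (α, n) : Vtx K N) * ‖T n‖ := by
  have hw : ∀ n, 0 ≤ wt (s - 2) (Sum.inr (α, n) : Vtx K N) := fun n => (wt_pos _ _).le
  have hwt : ∀ (γ : Fin N) n, wt (s - 2) (Sum.inr (α, n) : Vtx K N)
      = wt (s - 2) (Sum.inr (γ, n) : Vtx K N) := fun _ _ => rfl
  let D : Vtx K N × ℕ → ℝ := fun p => wt (s - 2) (Sum.inr (α, p.2) : Vtx K N) * ‖k p.2 p.1 * f p.1‖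
  have hD0 : 0 ≤ D := fun p => mul_nonneg (hw _) (norm_nonneg _)
  have hfib : ∀ y, ∃ S, HasSum (fun n => D (y, n)) S ∧ S ≤ wt s y * ‖f y‖ := by
    rintro (x | ⟨γ, m⟩)
    · refine ⟨0, ?_, mul_nonneg (wt_pos _ _).le (norm_nonneg _)⟩
      simp [D, hinl]
    · refine ⟨_, hasSum_sum_of_ne_finset_zero (s := Finset.range m) fun n hn => ?_, ?_⟩
      · simp [D, hlt n γ m (by simpa using hn)]
      · have h1 : ∀ n ∈ Finset.range m, D (Sum.inr (γ, m), n)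
            ≤ wt (s - 2) (Sum.inr (γ, m) : Vtx K N) * (((m : ℝ) + 1) * ‖f (Sum.inr (γ, m))‖) := by
          intro n hn
          simp only [D]
          rw [norm_mul, hwt γ]
          exact mul_le_mul (wt_ray_mono (by linarith) γ (Finset.mem_range.1 hn).le)
            (mul_le_mul_of_nonneg_right (hle n γ m) (norm_nonneg _))
            (mul_nonneg (norm_nonneg _) (norm_nonneg _)) (wt_pos _ _).le
        refine (Finset.sum_le_card_nsmul _ _ _ h1).trans ?_
        rw [Finset.card_range, nsmul_eq_mul]
        have h2 := wt_add (s - 2) 2 (Sum.inr (γ, m) : Vtx K N)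
        have h3 := pow_le_wt (K := K) 2 γ m
        rw [sub_add_cancel] at h2
        push_cast at h3
        rw [h2]
        have h4 : (m : ℝ) * ((m : ℝ) + 1) ≤ wt 2 (Sum.inr (γ, m) : Vtx K N) := by
          refine le_trans ?_ h3
          have : (0 : ℝ) ≤ m := Nat.cast_nonneg m
          nlinarith
        calc (m : ℝ) * (wt (s - 2) (Sum.inr (γ, m) : Vtx K N)
              * (((m : ℝ) + 1) * ‖f (Sum.inr (γ, m))‖))
            = wt (s - 2) (Sum.inr (γ, m) : Vtx K N) * ((m : ℝ) * ((m : ℝ) + 1))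
              * ‖f (Sum.inr (γ, m))‖ := by ring
          _ ≤ _ := mul_le_mul_of_nonneg_right
              (mul_le_mul_of_nonneg_left h4 (wt_pos _ _).le) (norm_nonneg _)
  have hDs : Summable D := (summable_prod_of_nonneg hD0).2
    ⟨fun y => (hfib y).choose_spec.1.summable,
      Summable.of_nonneg_of_le (fun y => tsum_nonneg fun n => hD0 (y, n)) (fun y => by
        rw [(hfib y).choose_spec.1.tsum_eq]
        exact (hfib y).choose_spec.2) f.summable⟩
  have hDs' := hDs.prod_symm
  refine Summable.of_nonneg_of_le (fun n => mul_nonneg (hw n) (norm_nonneg _)) (fun n => ?_)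
    hDs'.prod
  have h1 : Summable fun y => D (y, n) := hDs'.prod_factor n
  have h2 : ∑' y, D (y, n) = wt (s - 2) (Sum.inr (α, n) : Vtx K N) * ∑' y, ‖k n y * f y‖ := by
    simp only [D]
    exact tsum_mul_left
  change _ ≤ ∑' y, D (y, n)
  rw [h2]
  refine mul_le_mul_of_nonneg_left ?_ (hw n)
  rw [← (hT n).tsum_eq]
  refine norm_tsum_le_tsum_norm ?_
  have h3 := h1.mul_left (wt (s - 2) (Sum.inr (α, n) : Vtx K N))⁻¹
  refine h3.congr fun y => ?_
  simp only [D]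
  rw [inv_mul_cancel_left₀ (wt_pos _ _).ne']

variable [Fintype K] (E₀ : SimpleGraph K) (a : Fin N → K)

lemma continuous_freeOp_apply {s : ℝ} (x : Vtx K N) :
    Continuous fun u : Linf K N s => freeOp E₀ a u x := by
  have ev := fun x : Vtx K N => Linf.continuous_apply (s := s) x
  rcases x with x | ⟨α, _ | n⟩
  · refine Continuous.add (continuous_finsetSum _ fun y _ => ?_)
      (continuous_finsetSum _ fun α _ => ?_)
    · split_ifs
      · exact (ev _).sub (ev _)
      · exact continuous_const
    · split_ifs
      · exact ev _
      · exact continuous_const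
  · exact (continuous_const.mul (ev _)).sub (ev _)
  · exact ((continuous_const.mul (ev _)).sub (ev _)).sub (ev _)

/-- The zeroth coefficient of the free resolvent is a right inverse of `H₀`. -/
lemma freeOp_coeff_zero {s : ℝ} (hs : 0 ≤ s) {n : ℕ} (hn : 0 < n) {g : ℕ → Bop K N s}
    (hg : HasExpansion (fun κ => toBop hs (Ring.inverse (freeHil E₀ a + κ ^ 2 • 1))) g n)
    (f : Lone K N s) (x : Vtx K N) : freeOp E₀ a (g 0 f) x = f x := by
  -- Point values of the resolvent equation `(H₀ + κ²) R₀(κ) f = f` pass to the limit, where the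
  -- term with `κ²` drops out.
  have h1 : Tendsto (fun κ : ℂ => toBop hs (Ring.inverse (freeHil E₀ a + κ ^ 2 • 1)) f) rightZero
      (𝓝 (g 0 f)) :=
    ((ContinuousLinearMap.apply ℂ (Linf K N s) f).continuous.tendsto _).comp (hg.tendsto hn)
  have h2 := ((continuous_freeOp_apply E₀ a x).tendsto _).comp h1
  have h3 := ((Linf.continuous_apply x).tendsto _).comp h1
  have h4 := h2.add ((tendsto_rightZero.pow 2).mul h3)
  rw [zero_pow two_ne_zero, zero_mul, add_zero] at h4
  refine tendsto_nhds_unique h4 (tendsto_const_nhds.congr' ?_)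
  filter_upwards [eventually_re_pos] with κ hκ
  have h5 : (freeHil E₀ a + κ ^ 2 • 1) (Ring.inverse (freeHil E₀ a + κ ^ 2 • 1) (Lone.toHil hs f))
      = Lone.toHil hs f := by
    rw [← mul_apply_eq_comp, Ring.mul_inverse_cancel _ (isUnit_freeHil_add E₀ a hκ),
      one_apply_eq_self]
  exact (congrArg (fun u : Hil K N => u x) h5).symm

/-- The zeroth coefficient of the free resolvent maps `𝓛^s` to `ℂ𝟏 ⊕ 𝓛^{s-2}`. -/
lemma coeff_zero_mem {s : ℝ} (hs : 2 ≤ s) {A : (K → ℂ) →L[ℂ] (K → ℂ)} {T : Bop K N s}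
    (hT : HasKernel T (blockKernel A fun _ => 1)) (f : Lone K N s) :
    (T f : Vtx K N → ℂ) ∈ Submodule.span ℂ (Set.range (rayOne K)) ⊔ l1Sub K N (s - 2) := by
  classical
  -- At zero energy the half-line kernel is `min n m + 1`, which equals `m + 1` as soon as `n ≥ m`.
  -- Pairing `f` with this limit gives the constant value at infinity, and the difference from it is
  -- supported on `m > n`.
  let w : Fin N → Vtx K N → ℂ := fun α y =>
    Sum.elim (fun _ => 0) (fun p => if p.1 = α then (p.2 : ℂ) + 1 else 0) y
  have hnat : ∀ m : ℕ, ‖(m : ℂ) + 1‖ = (m : ℝ) + 1 := fun m => by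
    exact_mod_cast Complex.norm_natCast (m + 1)
  have hwle : ∀ α y, ‖w α y‖ ≤ wt s y := by
    rintro α (x | ⟨γ, m⟩)
    · simp [w, wt]
    · simp only [w, Sum.elim_inr]
      split_ifs
      · rw [hnat]
        have h1 := pow_le_wt (K := K) 1 γ m
        have h2 := wt_mono (by push_cast; linarith : ((1 : ℕ) : ℝ) ≤ s) (Sum.inr (γ, m) : Vtx K N)
        rw [pow_one] at h1
        linarith
      · simpa using (wt_pos s _).le
  have hwsum : ∀ α, Summable fun y => w α y * f y := fun α =>
    Summable.of_norm_bounded f.summable fun y => by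
      rw [norm_mul]
      exact mul_le_mul_of_nonneg_right (hwle α y) (norm_nonneg _)
  have hray : ∀ n m : ℕ, rayKernel (fun _ => 1) n m = ((min n m + 1 : ℕ) : ℂ) := fun n m => by
    simp [rayKernel]
  set Φ : Vtx K N → ℂ := ∑ α, (∑' y, w α y * f y) • rayOne K α with hΦ
  have hΦinr : ∀ α n, Φ (Sum.inr (α, n)) = ∑' y, w α y * f y := fun α n => by
    simp [hΦ, rayOne]
  have hmem : (T f : Vtx K N → ℂ) - Φ ∈ l1Sub K N (s - 2) := by
    refine summable_vtx fun α => ?_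
    refine summable_ray_tail hs f α _ (fun n y => blockKernel A (fun _ => 1) (Sum.inr (α, n)) y - w α y)
      (fun n => ?_) (fun n x => ?_) (fun n γ m h => ?_) (fun n γ m => ?_)
    · simp only [Pi.sub_apply, hΦinr, sub_mul]
      exact (hT f _).sub (hwsum α).hasSum
    · simp [blockKernel, w]
    · simp only [blockKernel, w, Sum.elim_inr, hray, min_eq_right h, eq_comm (a := γ)]
      split_ifs <;> simp
    · simp only [blockKernel, w, Sum.elim_inr, hray, eq_comm (a := γ)]
      split_ifs
      · rcases le_total m n with h | h
        · rw [min_eq_right h]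
          push_cast
          rw [sub_self, norm_zero]
          positivity
        · obtain ⟨k, rfl⟩ := Nat.exists_eq_add_of_le h
          rw [min_eq_left h]
          have e : ((n + 1 : ℕ) : ℂ) - (((n + k : ℕ) : ℂ) + 1) = -(k : ℂ) := by push_cast; ring
          rw [e, norm_neg, Complex.norm_natCast]
          push_cast
          have : (0 : ℝ) ≤ n := Nat.cast_nonneg n
          linarith
      · simp only [sub_zero, norm_zero]
        positivity
  have hspan : Φ ∈ Submodule.span ℂ (Set.range (rayOne K (N := N))) :=
    Submodule.sum_mem _ fun α _ => Submodule.smul_mem _ _ (Submodule.subset_span ⟨α, rfl⟩)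
  have h := Submodule.add_mem_sup hspan hmem
  rwa [add_sub_cancel] at h

end ZeroEnergy

/-! ### The symmetrized resolvent identity -/

section ResolventFormula

variable {H 𝒦 : Type*} [NormedAddCommGroup H] [NormedSpace ℂ H] [NormedAddCommGroup 𝒦]
  [NormedSpace ℂ 𝒦]

/-- The symmetrized resolvent identity for `A + w U w'` with `U² = 1`. -/
lemma isUnit_add_and_inverse_eq {A : H →L[ℂ] H} (hA : IsUnit A) {U : 𝒦 →L[ℂ] 𝒦} (hU : U * U = 1)
    (w : 𝒦 →L[ℂ] H) (w' : H →L[ℂ] 𝒦)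
    (hM : IsUnit (U + w'.comp ((Ring.inverse A).comp w))) :
    IsUnit (A + w.comp (U.comp w')) ∧
      Ring.inverse (A + w.comp (U.comp w')) = Ring.inverse A - (Ring.inverse A).comp (w.comp
        ((Ring.inverse (U + w'.comp ((Ring.inverse A).comp w))).comp
          (w'.comp (Ring.inverse A)))) := by
  set M := U + w'.comp ((Ring.inverse A).comp w) with hMdef
  set R := Ring.inverse A with hR
  set Mi := Ring.inverse M with hMi
  have hAR : ∀ f, A (R f) = f := fun f => by
    simpa using DFunLike.congr_fun (Ring.mul_inverse_cancel _ hA) f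
  have hRA : ∀ f, R (A f) = f := fun f => by
    simpa using DFunLike.congr_fun (Ring.inverse_mul_cancel _ hA) f
  have hUU : ∀ k, U (U k) = k := fun k => by simpa using DFunLike.congr_fun hU k
  have hMMi : ∀ k, U (Mi k) + w' (R (w (Mi k))) = k := fun k => by
    simpa [hMdef] using DFunLike.congr_fun (Ring.mul_inverse_cancel _ hM) k
  have hMiM : ∀ k, Mi (U k + w' (R (w k))) = k := fun k => by
    simpa [hMdef] using DFunLike.congr_fun (Ring.inverse_mul_cancel _ hM) k
  have h1 : (A + w.comp (U.comp w')) * (R - R.comp (w.comp (Mi.comp (w'.comp R)))) = 1 := by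
    ext f
    -- From `M M⁻¹ = 1`, multiplied by `U` from the left with `U² = 1`.
    have e : U (w' (R (w (Mi (w' (R f)))))) = U (w' (R f)) - Mi (w' (R f)) := by
      rw [eq_sub_of_add_eq' (hMMi (w' (R f))), map_sub, hUU]
    simp only [mul_apply_eq_comp, add_apply, sub_apply, ContinuousLinearMap.comp_apply, map_sub,
      hAR, e, one_apply_eq_self]
    abel
  have h2 : (R - R.comp (w.comp (Mi.comp (w'.comp R)))) * (A + w.comp (U.comp w')) = 1 := by
    ext f
    -- From `M⁻¹ M = 1`, applied to `U w' f`.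
    have e : Mi (w' f + w' (R (w (U (w' f))))) = U (w' f) := by
      have := hMiM (U (w' f))
      rwa [hUU] at this
    simp only [mul_apply_eq_comp, add_apply, sub_apply, ContinuousLinearMap.comp_apply, map_add,
      hRA, one_apply_eq_self] at e ⊢
    rw [eq_sub_of_add_eq' e, map_sub, map_sub]
    abel
  let u : (H →L[ℂ] H)ˣ := ⟨_, _, h1, h2⟩
  exact ⟨u.isUnit, Ring.inverse_unit u⟩

end ResolventFormula

/-! ### The perturbed resolvent at a regular threshold -/

section Perturbation

variable {K : Type*} {N : ℕ}
  {𝒦 : Type*} [NormedAddCommGroup 𝒦] [InnerProductSpace ℂ 𝒦] [CompleteSpace 𝒦]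
  {β : ℕ} {V : Hil K N →L[ℂ] Hil K N} {v : 𝒦 →L[ℂ] Lone K N (β : ℝ)} {U : 𝒦 →L[ℂ] 𝒦}

lemma RayGraph.Admissible.mul_self (hV : Admissible β V v U) : U * U = 1 := by
  have h := Unitary.star_mul_self_of_mem hV.unitary_U
  rwa [hV.selfAdjoint_U.star_eq] at h

variable [Fintype K] {E₀ : SimpleGraph K} {a : Fin N → K}

/-- At a regular threshold the leading coefficient `U + v* G₀ v` is invertible. -/
lemma isUnit_leading_coeff {s : ℝ} (hs0 : 0 ≤ s) (hs : 2 ≤ s) {v : 𝒦 →L[ℂ] Lone K N s}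
    {U : 𝒦 →L[ℂ] 𝒦} (hv : Function.Injective v) (hU : U * U = 1)
    (hreg : resEig E₀ a v U = ⊥) {n : ℕ} (hn : 0 < n) {g : ℕ → Bop K N s}
    (hg : HasExpansion (fun κ => toBop hs0 (Ring.inverse (freeHil E₀ a + κ ^ 2 • 1))) g n)
    (hg1 : (g 0).MemB 1) {A : (K → ℂ) →L[ℂ] (K → ℂ)}
    (hgk : HasKernel (g 0) (blockKernel A fun _ => 1)) :
    IsUnit (U + (adjL v).comp ((g 0).comp v)) := by
  have hUU : ∀ k, U (U k) = k := fun k => by simpa using DFunLike.congr_fun hU k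
  set Q := (adjL v).comp ((g 0).comp v) with hQ
  have hinj : ∀ φ, U φ + Q φ = 0 → φ = 0 := by
    intro φ hφ
    -- For `Ψ = g₀ v φ` this says `v* Ψ = -U φ`, so `V Ψ = v U v* Ψ = -v φ`, which cancels `H₀ Ψ = v
    -- φ`.
    have hadj : adj v (g 0 (v φ)) = -U φ := eq_neg_of_add_eq_zero_right hφ
    have hker : g 0 (v φ) ∈ LinearMap.ker (genOp E₀ a v U) := by
      refine funext fun x => ?_
      rw [genOp_apply, hadj, map_neg, hUU, map_neg, freeOp_coeff_zero E₀ a hs0 hn hg]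
      exact add_neg_cancel _
    have hmem : (g 0 (v φ) : Vtx K N → ℂ) ∈ resEig E₀ a v U :=
      ⟨⟨_, hker, rfl⟩, coeff_zero_mem hs hgk (v φ)⟩
    rw [hreg, Submodule.mem_bot] at hmem
    have hvφ : v φ = 0 := Lone.ext_apply fun x => by
      rw [← freeOp_coeff_zero E₀ a hs0 hn hg (v φ) x, hmem, map_zero]
      rfl
    exact hv (hvφ.trans (map_zero v).symm)
  -- The extension of `g₀` to `𝓛^1` lets the operator factor through the embedding of `𝓛^s` in
  -- `𝓛^1`.
  have hcomp : IsCompactOperator Q := by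
    obtain ⟨T, hT⟩ := hg1
    have h1 : (1 : ℝ) ≤ s := by linarith
    have e : Q = (((adjL v).comp ((Linf.incl h1).comp T)).comp (Lone.incl h1)).comp v := by
      ext k
      have : g 0 (v k) = Linf.incl h1 (T (Lone.incl h1 (v k))) :=
        Linf.ext_apply fun x => (hT (Lone.incl h1 (v k)) (v k) (fun _ => rfl) x).symm
      simp only [hQ, ContinuousLinearMap.comp_apply, this]
    have h2 := (isCompactOperator_comp_incl hs h1
      ((adjL v).comp ((Linf.incl h1).comp T))).comp_clm v
    rw [e]
    exact h2
  have hUQ : IsCompactOperator (-(U.comp Q)) := (hcomp.clm_comp U).neg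
  have hUu : IsUnit U := ⟨⟨U, U, hU, hU⟩, rfl⟩
  -- With `U² = 1` one has `U + Q = U (1 + U Q)`; the Fredholm alternative for the compact `-U Q` at
  -- the value `1` leaves only an eigenvector to exclude.
  have hfac : U + Q = U * (algebraMap ℂ (𝒦 →L[ℂ] 𝒦) 1 - -(U.comp Q)) := by
    rw [map_one, sub_neg_eq_add, mul_add, mul_one]
    congr 1
    ext k
    exact (hUU (Q k)).symm
  rw [hfac]
  refine hUu.mul ?_
  rcases hUQ.hasEigenvalue_or_mem_resolventSet (μ := 1) one_ne_zero with h | h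
  · obtain ⟨x, hx⟩ := h.exists_hasEigenvector
    refine absurd (hinj x ?_) hx.2
    have h1 : -(U (Q x)) = x := by simpa using hx.apply_eq_smul
    have h2 : U x = -Q x := by
      rw [← h1, map_neg, hUU, h1]
    rw [h2, neg_add_cancel]
  · exact h

/-- Expansion of the resolvent at a regular threshold. -/
theorem exists_expansion_of_regular (hconn : E₀.Connected) (hN : 0 < N) (hβ : 2 ≤ β)
    (hV : Admissible β V v U) (hreg : resEig E₀ a v U = ⊥) :
    ∃ G : ℕ → Bop K N (β : ℝ),
      (∀ᶠ κ in rightZero, -κ ^ 2 ∈ resolventSet ℂ (schr E₀ a V)) ∧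
      HasExpansion (fun κ => toBop (Nat.cast_nonneg β) (resolv E₀ a V κ)) G (β - 1) ∧
      ∀ j < β - 1, (G j).MemB ((max j 1 : ℕ) : ℝ) := by
  obtain ⟨n, rfl⟩ : ∃ n, β = n + 2 := ⟨β - 2, by omega⟩
  have hn : n + 2 - 1 = n + 1 := rfl
  rw [hn]
  have hs0 : (0 : ℝ) ≤ ((n + 2 : ℕ) : ℝ) := Nat.cast_nonneg _
  obtain ⟨g, hg, hgm, hgk⟩ := exists_free_expansion E₀ a hconn hN (n := n + 1) (by omega) hs0
    (by push_cast; linarith)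
  have hUU := hV.mul_self
  set F : ℂ → Bop K N ((n + 2 : ℕ) : ℝ) :=
    fun κ => toBop hs0 (Ring.inverse (freeHil E₀ a + κ ^ 2 • 1)) with hF
  -- `T ↦ v* T v`, and below `W : T ↦ v T v*`, as bounded linear maps, so that expansions pass
  -- through them.
  let L : Bop K N ((n + 2 : ℕ) : ℝ) →L[ℂ] (𝒦 →L[ℂ] 𝒦) :=
    (ContinuousLinearMap.compL ℂ 𝒦 (Linf K N ((n + 2 : ℕ) : ℝ)) 𝒦 (adjL v)).comp
      ((ContinuousLinearMap.compL ℂ 𝒦 (Lone K N ((n + 2 : ℕ) : ℝ))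
        (Linf K N ((n + 2 : ℕ) : ℝ))).flip v)
  have hL : ∀ T, L T = (adjL v).comp (T.comp v) := fun T => rfl
  have hMexp := (HasExpansion.const U (n + 1)).add (hg.clm L)
  have hM0 : IsUnit (U + (adjL v).comp ((g 0).comp v)) :=
    isUnit_leading_coeff hs0 (by push_cast; linarith) hV.injective hUU hreg (by omega) hg
      (by simpa using hgm 0 (by omega)) hgk
  have hM0' : IsUnit ((if 0 = 0 then U else 0) + L (g 0)) := by simpa [hL] using hM0
  obtain ⟨b, hb⟩ := hMexp.ring_inverse n hM0'
  have hMu : ∀ᶠ κ in rightZero, IsUnit (U + L (F κ)) :=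
    (hMexp.tendsto n.succ_pos).eventually (Units.isOpen.mem_nhds hM0')
  let W : (𝒦 →L[ℂ] 𝒦) →L[ℂ] (Linf K N ((n + 2 : ℕ) : ℝ) →L[ℂ] Lone K N ((n + 2 : ℕ) : ℝ)) :=
    (ContinuousLinearMap.compL ℂ _ 𝒦 _ v).comp
      ((ContinuousLinearMap.compL ℂ (Linf K N ((n + 2 : ℕ) : ℝ)) 𝒦 𝒦).flip (adjL v))
  have hW : ∀ T, W T = v.comp (T.comp (adjL v)) := fun T => rfl
  have hfac : ∀ κ : ℂ, schr E₀ a V + κ ^ 2 • 1 = (freeHil E₀ a + κ ^ 2 • 1)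
      + ((Lone.toHil hs0).comp v).comp (U.comp ((adjL v).comp (Linf.ofHil hs0))) := by
    intro κ
    have : V = ((Lone.toHil hs0).comp v).comp (U.comp ((adjL v).comp (Linf.ofHil hs0))) :=
      ContinuousLinearMap.ext fun f => Subtype.ext (funext fun x => hV.factor f x)
    rw [← this, schr]
    abel
  have hres : ∀ᶠ κ in rightZero, IsUnit (schr E₀ a V + κ ^ 2 • 1) ∧
      F κ - (F κ).comp ((W (Ring.inverse (U + L (F κ)))).comp (F κ))
        = toBop hs0 (resolv E₀ a V κ) := by
    filter_upwards [eventually_re_pos, hMu] with κ hκ hM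
    -- With the embeddings of `𝓛^β` in `𝓗` and of `𝓗` in `(𝓛^β)*` put into `w` and `w'`, the
    -- operator `U + w' A⁻¹ w` is by definition `U + L (F κ)`.
    obtain ⟨h1, h2⟩ := isUnit_add_and_inverse_eq (isUnit_freeHil_add E₀ a hκ) hUU
      ((Lone.toHil hs0).comp v) ((adjL v).comp (Linf.ofHil hs0)) hM
    rw [← hfac] at h1 h2
    refine ⟨h1, ?_⟩
    rw [resolv, h2]
    rfl
  have hexp := hg.sub (hg.bilin ((hb.clm W).bilin hg (ContinuousLinearMap.compL ℂ _ _ _))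
    (ContinuousLinearMap.compL ℂ _ _ _))
  refine ⟨_, ?_, hexp.congr (hres.mono fun κ h => h.2), fun j hj => ?_⟩
  · filter_upwards [hres] with κ hκ
    rw [spectrum.mem_resolventSet_iff]
    have e : algebraMap ℂ (Hil K N →L[ℂ] Hil K N) (-κ ^ 2) - schr E₀ a V
        = -(schr E₀ a V + κ ^ 2 • 1) := by
      rw [Algebra.algebraMap_eq_smul_one, neg_smul]
      abel
    rw [e]
    exact hκ.1.neg
  · have hle : ((max j 1 : ℕ) : ℝ) ≤ ((n + 2 : ℕ) : ℝ) := by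
      exact_mod_cast (by omega : max j 1 ≤ n + 2)
    -- In the Cauchy products only free coefficients of index at most `j` occur, and the middle
    -- factor maps `(𝓛^β)*` into `𝓛^β`, so the weight `max j 1` is preserved.
    have hgj : ∀ i ≤ j, (g i).MemB ((max j 1 : ℕ) : ℝ) := fun i hi =>
      (hgm i (by omega)).mono (by exact_mod_cast max_le_max_right 1 hi)
    refine (hgj j le_rfl).sub (Bop.MemB.sum _ fun p hp => ?_)
    have hp' := Finset.HasAntidiagonal.mem_antidiagonal.1 hp
    rw [map_sum]
    refine Bop.MemB.sum _ fun q hq => ?_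
    have hq' := Finset.HasAntidiagonal.mem_antidiagonal.1 hq
    exact Bop.MemB.comp hle (hgj _ (by omega)) (hgj _ (by omega)) (W (b q.1))

/-- A linearly independent family in the zero space is empty, so the only possible sum is `0`; the
empty family shows that it occurs. Existence and independence of the basis are thus both covered. -/
lemma isBoundProj_iff {s : ℝ} {v : 𝒦 →L[ℂ] Lone K N s} (h : boundEig E₀ a v U = ⊥)
    (T : Bop K N s) : IsBoundProj E₀ a v U T ↔ T = 0 := by
  constructor
  · rintro ⟨n, Ψ, hΨ, hT⟩
    have hn : IsEmpty (Fin n) := ⟨fun γ => by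
      have h1 : Ψ γ ∈ boundEig E₀ a v U := hΨ.span_eq ▸ Submodule.subset_span ⟨γ, rfl⟩
      rw [h, Submodule.mem_bot] at h1
      exact hΨ.linearIndependent.ne_zero γ h1⟩
    refine ContinuousLinearMap.ext fun u => Linf.ext_apply fun x => ?_
    rw [hT u x, Finset.univ_eq_empty, Finset.sum_empty]
    rfl
  · rintro rfl
    refine ⟨0, Fin.elim0, ⟨linearIndependent_empty_type, ?_, fun γ => γ.elim0, fun γ => γ.elim0⟩,
      fun u x => ?_⟩
    · rw [h, Set.range_eq_empty, Submodule.span_empty]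
    · rw [Finset.univ_eq_empty, Finset.sum_empty]
      rfl

/-- As for the bound projection: the classes of a resonance basis are linearly independent, hence
nonzero, which is impossible when `𝓔 = 0`. -/
lemma isResonanceProj_iff {s : ℝ} {v : 𝒦 →L[ℂ] Lone K N s} (hres : resEig E₀ a v U = ⊥)
    (h : boundEig E₀ a v U = ⊥) (T : Bop K N s) : IsResonanceProj E₀ a v U T ↔ T = 0 := by
  constructor
  · rintro ⟨n, Ψ, hΨ, hT⟩
    have hn : IsEmpty (Fin n) := ⟨fun γ => by
      have h1 : Ψ γ ∈ resEig E₀ a v U :=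
        hΨ.span_sup ▸ Submodule.mem_sup_left (Submodule.subset_span ⟨γ, rfl⟩)
      rw [hres, Submodule.mem_bot] at h1
      exact hΨ.linearIndependent.ne_zero γ (by rw [h1, map_zero])⟩
    refine ContinuousLinearMap.ext fun u => Linf.ext_apply fun x => ?_
    rw [hT u x, Finset.univ_eq_empty, Finset.sum_empty]
    rfl
  · rintro rfl
    refine ⟨0, Fin.elim0, ⟨linearIndependent_empty_type, ?_, fun γ => γ.elim0, fun γ => γ.elim0,
      ⟨Fin.elim0, ⟨fun γ => γ.elim0, fun γ => γ.elim0⟩, fun γ => γ.elim0⟩⟩, fun u x => ?_⟩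
    · rw [h, hres, Set.range_eq_empty, Submodule.span_empty, bot_sup_eq]
    · rw [Finset.univ_eq_empty, Finset.sum_empty]
      rfl

end Perturbation

lemma sum_Icc_eq_sum_range {E : Type*} [AddCommMonoid E] {β : ℕ} (hβ : 2 ≤ β) (f : ℤ → E)
    (hf : ∀ j < 0, f j = 0) :
    ∑ j ∈ Finset.Icc (-2 : ℤ) ((β : ℤ) - 2), f j = ∑ j ∈ Finset.range (β - 1), f j := by
  rw [← Finset.sum_image (g := ((↑) : ℕ → ℤ)) (f := f) (by simp)]
  symm
  refine Finset.sum_subset (fun j hj => ?_) fun j hj hj' => hf j ?_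
  · obtain ⟨i, hi, rfl⟩ := Finset.mem_image.1 hj
    have := Finset.mem_range.1 hi
    rw [Finset.mem_Icc]
    omega
  · by_contra h
    have := Finset.mem_Icc.1 hj
    exact hj' (Finset.mem_image.2 ⟨j.toNat, Finset.mem_range.2 (by omega), by omega⟩)

end

theorem theorem3p5 {K : Type*} [Fintype K] (E₀ : SimpleGraph K) (hconn : E₀.Connected)
    {N : ℕ} (hN : 0 < N) (a : Fin N → K)
    {𝒦 : Type*} [NormedAddCommGroup 𝒦] [InnerProductSpace ℂ 𝒦] [CompleteSpace 𝒦]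
    (β : ℕ) (hβ : 2 ≤ β)
    (V : Hil K N →L[ℂ] Hil K N) (v : 𝒦 →L[ℂ] Lone K N (β : ℝ)) (U : 𝒦 →L[ℂ] 𝒦)
    (hV : Admissible β V v U) (hreg : IsRegularThreshold E₀ a v U) :
    ∃ G : ℤ → Bop K N (β : ℝ),
      -- the resolvent exists and has the expansion, as `κ → 0` with `Re κ > 0`
      (∀ᶠ κ : ℂ in 𝓝[{κ : ℂ | 0 < κ.re}] 0, -κ ^ 2 ∈ resolventSet ℂ (schr E₀ a V)) ∧
      ((fun κ : ℂ => toBop (Nat.cast_nonneg β) (resolv E₀ a V κ)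
          - ∑ j ∈ Finset.Icc (-2 : ℤ) ((β : ℤ) - 2), κ ^ j • G j)
        =O[𝓝[{κ : ℂ | 0 < κ.re}] 0] fun κ : ℂ => κ ^ (β - 1)) ∧
      -- the weighted spaces of the coefficients
      (∀ j : ℤ, 0 ≤ j → j ≤ (β : ℤ) - 2 →
        (Even j → (G j).MemB ((j : ℝ) + 1)) ∧ (Odd j → (G j).MemB (j : ℝ))) ∧
      -- there is no singular part: `G₋₂ = 𝖯 = 0` and `G₋₁ = 𝓟 = 0`
      ((∀ T : Bop K N (β : ℝ), IsBoundProj E₀ a v U T ↔ T = G (-2)) ∧ G (-2) = 0) ∧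
      ((∀ T : Bop K N (β : ℝ), IsResonanceProj E₀ a v U T ↔ T = G (-1)) ∧ G (-1) = 0) := by

  obtain ⟨G, hG, hexp, hmem⟩ := exists_expansion_of_regular hconn hN hβ hV hreg.1
  -- Coefficients of negative index are set to `0`, so the integer-indexed sum reduces to the one
  -- over `0 ≤ j < β - 1`.
  refine ⟨fun j => if j < 0 then 0 else G j.toNat, hG, ?_, fun j hj0 hj => ?_,
    ⟨fun T => by simpa using isBoundProj_iff hreg.2 T, by simp⟩,
    ⟨fun T => by simpa using isResonanceProj_iff hreg.1 hreg.2 T, by simp⟩⟩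
  · refine IsBigO.congr_left hexp fun κ => ?_
    rw [sum_Icc_eq_sum_range hβ _ fun j hj => by simp [hj]]
    simp [not_lt.2 (Int.natCast_nonneg _)]
  · lift j to ℕ using hj0
    have hj' : j < β - 1 := by omega
    have h := hmem j hj'
    simp only [not_lt.2 (Int.natCast_nonneg j), if_false, Int.toNat_natCast]
    -- Both weights come from `max j 1`: it is at most `j + 1` always, and equal to `j` when `j` is
    -- odd, since then `j ≥ 1`.
    refine ⟨fun _ => h.mono ?_, fun ho => h.mono ?_⟩
    · exact_mod_cast (by omega : max j 1 ≤ j + 1)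
    · obtain ⟨k, hk⟩ := ho
      exact_mod_cast (by omega : max j 1 ≤ j)
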